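/- **Setting.** Let $k$ be a field and let $Q$ be a finite simply laced quiver: finitely many vertices, no loops, and at most one arrow from a given vertex to another. Let $\Delta$ be a $Q$-set with zero compositions: a $k$-algebra $A_x$ for each vertex $x$ and a non-zero $A_{t(a)}$-$A_{s(a)}$-bimodule $M_a$ (over $k$) for each arrow $a$, all bimodule maps $M_b\otimes M_a\to M_c$ (and $M_b\otimes M_a\to A_x$) being zero. Put $A=\prod_x A_x$, $M=\bigoplus_a M_a$, and let $\Lambda=A\oplus M$ be the associated algebra, with $M^2=0$. Let $e_x$ be the unit of $A_x$ and $D=\prod_x k\subseteq A$. *The complexes.* Let $J^\bullet$ be the complex $J^n=\mathrm{Hom}_{D-D}(\Lambda^{\otimes_D n},\Lambda)$ with the Hochschild coboundary $d$. A trajectory of duration $n$ over a path $\omega=a_m\cdots a_1$ of $Q$ is a sequence $\tau=t(a_m)^{p_{m+1}},a_m,s(a_m)^{p_m},\dots,a_1,s(a_1)^{p_1}$ with $m+\sum p_i=n$ (waiting times $p_i\ge 0$; a vertex is a path of length $0$). Let $T_n(\omega)$ be the set of these trajectories. For $\tau\in T_n(\omega)$ let $\tau_\Delta$ be the tensor product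 over $k$ of the $A_x$ and $M_a$ in the order of the entries of $\tau$, let $\Delta_\omega=e_{t(\omega)}\Lambda e_{s(\omega)}$, and let $J_\tau=\mathrm{Hom}_k(\tau_\Delta,\Delta_\omega)$, a direct summand of $J^n$ by extension by zero (for $n=0$, $J_x=A_x$). For $f\in J^n$ let $f_\tau$ denote its component in $J_\tau$. Let $J^n_\omega=\bigoplus_{\tau\in T_n(\omega)}J_\tau$. *Cohomology along a path.* $H^\bullet_\omega(\Delta)$ is the cohomology of $(J^\bullet_\omega,\mathsf d)$, with $\mathsf d f_\tau=\sum_{\sigma\in\tau_0^+}(df_\tau)_\sigma$, where $\tau_0^+$ is the set of the trajectories obtained from $\tau$ by increasing one waiting time by $1$. *The connecting homomorphism.* Let $CQ$ be the set of cycles (paths $\gamma$ with $s(\gamma)=t(\gamma)$, the vertices included), let $DQ$ be the set of the other paths, and let $CQ_m$, $DQ_m$ be their subsets of paths of length $m$. The spaces $D^n=\bigoplus_{\delta\in DQ}J^n_\delta$ form a subcomplex of $J^\bullet$, with $H^n(D^\bullet)=\bigoplus_{\delta\in DQ}H^n_\delta(\Delta)$, and there is a canonical map $\bigoplus_{\gamma\in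 CQ}H^n_\gamma(\Delta)\to H^n((J/D)^\bullet)$. Through these identifications, the connecting homomorphism of the long exact sequence of $0\to D^\bullet\to J^\bullet\to (J/D)^\bullet\to 0$ is $$\nabla_n:\ \bigoplus_{\gamma\in CQ}H^n_\gamma(\Delta)\longrightarrow\bigoplus_{\delta\in DQ}H^{n+1}_\delta(\Delta).$$ *The cup product.* If $s(\omega')=t(\omega)$, the product $(f'\smile f)(x_1,\dots,x_{i+j})=f'(x_1,\dots,x_i)\,f(x_{i+1},\dots,x_{i+j})$ of cochains along $\omega'$ and $\omega$ induces $H^i_{\omega'}(\Delta)\times H^j_\omega(\Delta)\to H^{i+j}_{\omega'\omega}(\Delta)$; if $s(\omega')\ne t(\omega)$ the cup product is zero. This is extended bilinearly to $\bigoplus_\omega H^\bullet_\omega(\Delta)$, the sum running over all paths. For an arrow $a$, let $1_{M_a}\in H^1_a(\Delta)=\mathrm{End}_{A_{t(a)}-A_{s(a)}}M_a$ be the identity map, and let $1_M=\sum_{a}1_{M_a}$, the sum running over all arrows. **Theorem.** Let $m\le n$, let $\gamma\in CQ_m$ and let $f\in H^n_\gamma(\Delta)$. Then, in $\bigoplus_\omega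 H^{n+1}_\omega(\Delta)$, $$\nabla_n(f)=1_M\smile f+(-1)^{n+1}f\smile 1_M .$$ Moreover $\nabla_n(f)\in\bigoplus_{\delta\in DQ_{m+1}}H^{n+1}_\delta(\Delta)$. -/

import Mathlib

open CategoryTheory
open scoped DirectSum TensorProduct

universe u v w r

set_option linter.unusedSectionVars false

namespace PathCohomology

/-! ### Hochschild cochains of an algebra -/

section Hochschild

variable (k : Type u) [Field k] (Λ : Type w) [Ring Λ] [Algebra k Λ]

/-- `Hom_k(Λ^{⊗ n}, Λ)`, as `k`-multilinear maps in `n` variables. -/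
abbrev Coch (n : ℕ) := MultilinearMap k (fun _ : Fin n => Λ) Λ

variable {k Λ}

theorem contractNth_update_exists {n : ℕ} (i : Fin n) (m : Fin (n + 1) → Λ) (j : Fin (n + 1)) :
    ∃ (l : Fin n) (φ : Λ →ₗ[k] Λ), ∀ x,
      Fin.contractNth i.castSucc (· * ·) (Function.update m j x) =
        Function.update (Fin.contractNth i.castSucc (· * ·) m) l (φ x) := by
  rcases lt_trichotomy (j : ℕ) i with h | h | h
  · refine ⟨⟨j, by omega⟩, LinearMap.id, fun x => ?_⟩
    funext a
    by_cases ha : a = ⟨j, by omega⟩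
    · subst ha
      have : (Fin.castSucc (⟨j, by omega⟩ : Fin n)) = j := Fin.ext rfl
      simp [Fin.contractNth, h, this]
    · have h1 : a.castSucc ≠ j := fun e => ha (Fin.ext (by simpa using congrArg Fin.val e))
      have h2 : ¬ (a : ℕ) < i → a.succ ≠ j := fun e e' => by
        have := congrArg Fin.val e'; simp at this; omega
      simp only [Fin.contractNth, Function.update_of_ne ha, Function.update_of_ne h1]
      split_ifs with c1 c2
      · rfl
      · rw [Function.update_of_ne (h2 c1)]
      · rw [Function.update_of_ne (h2 c1)]
  · refine ⟨i, LinearMap.mulRight k (m i.succ), fun x => ?_⟩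
    have hj : j = i.castSucc := Fin.ext h
    subst hj
    funext a
    by_cases ha : a = i
    · subst ha
      have : a.succ ≠ a.castSucc := (Fin.castSucc_lt_succ).ne'
      simp [Fin.contractNth, Function.update_of_ne this]
    · have h1 : a.castSucc ≠ i.castSucc := fun e => ha (Fin.castSucc_injective _ e)
      have h3 : (a : ℕ) ≠ i := fun e => ha (Fin.ext e)
      have h2 : ¬ (a : ℕ) < i → a.succ ≠ i.castSucc := fun e e' => by
        have := congrArg Fin.val e'; simp at this; omega
      simp only [Fin.contractNth, Function.update_of_ne ha, Function.update_of_ne h1]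
      split_ifs with c1 c2
      · rfl
      · exact absurd c2 h3
      · rw [Function.update_of_ne (h2 c1)]
  · by_cases h' : (j : ℕ) = i + 1
    · refine ⟨i, LinearMap.mulLeft k (m i.castSucc), fun x => ?_⟩
      have hj : j = i.succ := Fin.ext h'
      subst hj
      funext a
      by_cases ha : a = i
      · subst ha
        have : a.castSucc ≠ a.succ := (Fin.castSucc_lt_succ).ne
        simp [Fin.contractNth, Function.update_of_ne this]
      · have h1 : a.succ ≠ i.succ := fun e => ha (Fin.succ_injective _ e)
        have h3 : (a : ℕ) ≠ i := fun e => ha (Fin.ext e)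
        have h2 : (a : ℕ) < i → a.castSucc ≠ i.succ := fun e e' => by
          have := congrArg Fin.val e'; simp at this; omega
        simp only [Fin.contractNth, Function.update_of_ne ha, Function.update_of_ne h1]
        split_ifs with c1 c2
        · rw [Function.update_of_ne (h2 c1)]
        · exact absurd c2 h3
        · rfl
    · refine ⟨⟨(j : ℕ) - 1, by omega⟩, LinearMap.id, fun x => ?_⟩
      funext a
      by_cases ha : a = ⟨(j : ℕ) - 1, by omega⟩
      · have hs : a.succ = j := Fin.ext (by simp [ha]; omega)
        have c1 : ¬ (a : ℕ) < i := by simp [ha]; omega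
        have c2 : ¬ (a : ℕ) = i := by simp [ha]; omega
        subst ha
        simp [Fin.contractNth, c1, c2, hs]
      · have h1 : a.succ ≠ j := fun e => ha (Fin.ext (by
          have := congrArg Fin.val e; simp at this; simp; omega))
        have h2 : (a : ℕ) ≤ i → a.castSucc ≠ j := fun e e' => by
          have := congrArg Fin.val e'; simp at this; omega
        simp only [Fin.contractNth, Function.update_of_ne ha, Function.update_of_ne h1]
        split_ifs with c1 c2
        · rw [Function.update_of_ne (h2 (by simp at c1; omega))]
        · rw [Function.update_of_ne (h2 (by simp at c2; omega))]
        · rfl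

/-- `x₁ ⊗ ⋯ ⊗ xₙ₊₁ ↦ x₁ f(x₂ ⊗ ⋯ ⊗ xₙ₊₁)`. -/
def leftFace (n : ℕ) : Coch k Λ n →ₗ[k] Coch k Λ (n + 1) where
  toFun f :=
    { toFun := fun v => v 0 * f (fun i => v i.succ)
      map_update_add' := by
        intro inst m i x y
        obtain rfl : inst = instDecidableEqFin _ := Subsingleton.elim _ _
        refine Fin.cases ?_ (fun j => ?_) i x y
        · intro x y
          simp [add_mul]
        · intro x y
          have h (z : Λ) : (fun a : Fin n => Function.update m j.succ z a.succ) =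
              Function.update (fun a => m a.succ) j z := by
            funext a
            by_cases ha : a = j
            · subst ha; rw [Function.update_self, Function.update_self]
            · rw [Function.update_of_ne ha, Function.update_of_ne]
              exact fun e => ha (Fin.succ_injective _ e)
          have h0 (z : Λ) : Function.update m j.succ z 0 = m 0 :=
            Function.update_of_ne (Fin.succ_ne_zero j).symm _ _
          simp [h, h0, mul_add]
      map_update_smul' := by
        intro inst m i c x
        obtain rfl : inst = instDecidableEqFin _ := Subsingleton.elim _ _
        refine Fin.cases ?_ (fun j => ?_) i x
        · intro x
          simp
        · intro x
          have h (z : Λ) : (fun a : Fin n => Function.update m j.succ z a.succ) =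
              Function.update (fun a => m a.succ) j z := by
            funext a
            by_cases ha : a = j
            · subst ha; rw [Function.update_self, Function.update_self]
            · rw [Function.update_of_ne ha, Function.update_of_ne]
              exact fun e => ha (Fin.succ_injective _ e)
          have h0 (z : Λ) : Function.update m j.succ z 0 = m 0 :=
            Function.update_of_ne (Fin.succ_ne_zero j).symm _ _
          simp [h, h0] }
  map_add' f g := by ext v; simp [mul_add]
  map_smul' c f := by ext v; simp

/-- `x₁ ⊗ ⋯ ⊗ xₙ₊₁ ↦ f(x₁ ⊗ ⋯ ⊗ xₙ) xₙ₊₁`. -/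
def rightFace (n : ℕ) : Coch k Λ n →ₗ[k] Coch k Λ (n + 1) where
  toFun f :=
    { toFun := fun v => f (fun i => v i.castSucc) * v (Fin.last n)
      map_update_add' := by
        intro inst m i x y
        obtain rfl : inst = instDecidableEqFin _ := Subsingleton.elim _ _
        refine Fin.lastCases ?_ (fun j => ?_) i x y
        · intro x y
          simp [mul_add]
        · intro x y
          have h (z : Λ) : (fun a : Fin n => Function.update m j.castSucc z a.castSucc) =
              Function.update (fun a => m a.castSucc) j z := by
            funext a
            by_cases ha : a = j
            · subst ha; rw [Function.update_self, Function.update_self]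
            · rw [Function.update_of_ne ha, Function.update_of_ne]
              exact fun e => ha (Fin.castSucc_injective _ e)
          have h0 (z : Λ) : Function.update m j.castSucc z (Fin.last n) = m (Fin.last n) :=
            Function.update_of_ne (Fin.castSucc_lt_last j).ne' _ _
          simp [h, h0, add_mul]
      map_update_smul' := by
        intro inst m i c x
        obtain rfl : inst = instDecidableEqFin _ := Subsingleton.elim _ _
        refine Fin.lastCases ?_ (fun j => ?_) i x
        · intro x
          simp
        · intro x
          have h (z : Λ) : (fun a : Fin n => Function.update m j.castSucc z a.castSucc) =
              Function.update (fun a => m a.castSucc) j z := by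
            funext a
            by_cases ha : a = j
            · subst ha; rw [Function.update_self, Function.update_self]
            · rw [Function.update_of_ne ha, Function.update_of_ne]
              exact fun e => ha (Fin.castSucc_injective _ e)
          have h0 (z : Λ) : Function.update m j.castSucc z (Fin.last n) = m (Fin.last n) :=
            Function.update_of_ne (Fin.castSucc_lt_last j).ne' _ _
          simp [h, h0] }
  map_add' f g := by ext v; simp [add_mul]
  map_smul' c f := by ext v; simp

/-- `x₁ ⊗ ⋯ ⊗ xₙ₊₁ ↦ f(x₁ ⊗ ⋯ ⊗ xᵢ xᵢ₊₁ ⊗ ⋯ ⊗ xₙ₊₁)` (the index `i` starts at `0` here). -/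
def midFace {n : ℕ} (i : Fin n) : Coch k Λ n →ₗ[k] Coch k Λ (n + 1) where
  toFun f :=
    { toFun := fun v => f (Fin.contractNth i.castSucc (· * ·) v)
      map_update_add' := by
        intro inst m j x y
        obtain rfl : inst = instDecidableEqFin _ := Subsingleton.elim _ _
        obtain ⟨l, φ, h⟩ := contractNth_update_exists (k := k) i m j
        simp [h]
      map_update_smul' := by
        intro inst m j c x
        obtain rfl : inst = instDecidableEqFin _ := Subsingleton.elim _ _
        obtain ⟨l, φ, h⟩ := contractNth_update_exists (k := k) i m j
        simp [h] }
  map_add' f g := by ext v; simp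
  map_smul' c f := by ext v; simp

/-- The Hochschild coboundary. -/
def hd (n : ℕ) : Coch k Λ n →ₗ[k] Coch k Λ (n + 1) :=
  leftFace n + ∑ i : Fin n, (-1 : k) ^ ((i : ℕ) + 1) • midFace i + (-1 : k) ^ (n + 1) • rightFace n

theorem hd_apply {n : ℕ} (f : Coch k Λ n) (x : Fin (n + 1) → Λ) :
    hd n f x = x 0 * f (fun i => x i.succ)
      + ∑ i : Fin n, (-1 : k) ^ ((i : ℕ) + 1) • f (Fin.contractNth i.castSucc (· * ·) x)
      + (-1 : k) ^ (n + 1) • (f (fun i => x i.castSucc) * x (Fin.last n)) := by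
  simp [hd, leftFace, rightFace, midFace, LinearMap.sum_apply]

/-- The cup product of two cochains: `(f' ⌣ f)(x₁, …, x_{i+j}) = f'(x₁, …, xᵢ) f(xᵢ₊₁, …, x_{i+j})`,
defined as the composition of `f' ⊗ f` with the product of `Λ`. -/
noncomputable def cupC {i j n : ℕ} (h : i + j = n) :
    Coch k Λ i →ₗ[k] Coch k Λ j →ₗ[k] Coch k Λ n :=
  LinearMap.mk₂ k
    (fun f' f => ((LinearMap.mul' k Λ).compMultilinearMap (f'.domCoprod f)).domDomCongr
      (finSumFinEquiv.trans (finCongr h)))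
    (by intros; ext; simp [add_mul]) (by intros; ext; simp)
    (by intros; ext; simp [mul_add]) (by intros; ext; simp)

theorem cupC_apply {i j n : ℕ} (h : i + j = n) (f' : Coch k Λ i) (f : Coch k Λ j)
    (v : Fin n → Λ) :
    cupC h f' f v = f' (fun a => v (Fin.cast h (Fin.castAdd j a))) *
      f (fun b => v (Fin.cast h (Fin.natAdd i b))) := by
  simp [cupC]

/-! #### Evaluation on sequences indexed by `ℕ` -/

/-- A cochain evaluated on the first `n` terms of an infinite sequence. -/
def ev {n : ℕ} (f : Coch k Λ n) (v : ℕ → Λ) : Λ := f (fun i => v i)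

theorem ev_ext {n : ℕ} {f g : Coch k Λ n} (h : ∀ v, ev f v = ev g v) : f = g := by
  ext v
  have := h (fun i => if hi : i < n then v ⟨i, hi⟩ else 0)
  simpa [ev] using this

theorem ev_congr {n : ℕ} (f : Coch k Λ n) {v w : ℕ → Λ} (h : ∀ i < n, v i = w i) :
    ev f v = ev f w := by
  unfold ev; congr 1; funext i; exact h i i.2

theorem ev_zero {n : ℕ} (f : Coch k Λ n) {v : ℕ → Λ} (i : ℕ) (hi : i < n) (h : v i = 0) :
    ev f v = 0 := f.map_coord_zero ⟨i, hi⟩ h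

theorem ev_add {n : ℕ} (f g : Coch k Λ n) (v) : ev (f + g) v = ev f v + ev g v := rfl
theorem ev_sub {n : ℕ} (f g : Coch k Λ n) (v) : ev (f - g) v = ev f v - ev g v := rfl
theorem ev_smul {n : ℕ} (c : k) (f : Coch k Λ n) (v) : ev (c • f) v = c • ev f v := rfl
theorem ev_z {n : ℕ} (v) : ev (0 : Coch k Λ n) v = 0 := rfl
theorem ev_sum {n : ℕ} {ι : Type*} (s : Finset ι) (f : ι → Coch k Λ n) (v) :
    ev (∑ i ∈ s, f i) v = ∑ i ∈ s, ev (f i) v := by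
  simp [ev]

/-- Contraction of the terms `i` and `i + 1` of a sequence. -/
def ctr (i : ℕ) (v : ℕ → Λ) : ℕ → Λ := fun j =>
  if j < i then v j else if j = i then v j * v (j + 1) else v (j + 1)

/-- The `i`-th coface. -/
def cof (n i : ℕ) (φ : (ℕ → Λ) → Λ) (v : ℕ → Λ) : Λ :=
  if i = 0 then v 0 * φ (fun j => v (j + 1)) else if i = n + 1 then φ v * v n
  else φ (ctr (i - 1) v)

theorem ev_leftFace {n : ℕ} (f : Coch k Λ n) (v : ℕ → Λ) :
    ev (leftFace n f) v = v 0 * ev f (fun j => v (j + 1)) := rfl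
theorem ev_rightFace {n : ℕ} (f : Coch k Λ n) (v : ℕ → Λ) :
    ev (rightFace n f) v = ev f v * v n := rfl
theorem ev_midFace {n : ℕ} (i : Fin n) (f : Coch k Λ n) (v : ℕ → Λ) :
    ev (midFace i f) v = ev f (ctr i v) := rfl

theorem ev_hd {n : ℕ} (f : Coch k Λ n) (v : ℕ → Λ) :
    ev (hd n f) v = ∑ i ∈ Finset.range (n + 2), (-1 : k) ^ i • cof n i (ev f) v := by
  rw [Finset.sum_range_succ, Finset.sum_range_succ', hd]
  simp only [LinearMap.add_apply, LinearMap.sum_apply, LinearMap.smul_apply, ev_add, ev_sum,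
    ev_smul, ev_leftFace, ev_rightFace, ev_midFace]
  have : ∀ i ∈ Finset.range n, (-1 : k) ^ (i + 1) • cof n (i + 1) (ev f) v =
      (-1 : k) ^ (i + 1) • ev f (ctr i v) := by
    intro i hi
    have : i < n := Finset.mem_range.1 hi
    simp [cof, this.ne]
  rw [Finset.sum_congr rfl this, ← Fin.sum_univ_eq_sum_range
    (fun i => (-1 : k) ^ (i + 1) • ev f (ctr i v)) n]
  simp [cof, add_comm]

theorem cof_sum {n m i : ℕ} (φ : ℕ → (ℕ → Λ) → Λ) (c : ℕ → k) (v : ℕ → Λ) :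
    cof n i (fun v => ∑ j ∈ Finset.range m, c j • φ j v) v =
      ∑ j ∈ Finset.range m, c j • cof n i (φ j) v := by
  unfold cof
  split_ifs
  · simp [Finset.mul_sum]
  · simp [Finset.sum_mul]
  · rfl

theorem cof_cof {n i j : ℕ} (f : Coch k Λ n) (hij : i < j) (hj : j ≤ n + 2) (v : ℕ → Λ) :
    cof (n + 1) j (cof n i (ev f)) v = cof (n + 1) i (cof n (j - 1) (ev f)) v := by
  rcases Nat.eq_zero_or_pos i with rfl | hi
  · by_cases h1 : j = 1
    · subst h1
      simp [cof, ctr, mul_assoc]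
    · by_cases h2 : j = n + 2
      · subst h2
        simp [cof, mul_assoc]
      · have e1 : j ≠ 0 := by omega
        have e2 : j - 1 ≠ 0 := by omega
        have e3 : j - 1 ≠ n + 1 := by omega
        have e4 : j ≠ n + 1 + 1 := by omega
        simp only [cof, e1, e2, e3, e4, if_false, if_true]
        have : 0 < j - 1 := by omega
        congr 1
        · simp [ctr, this]
        · apply ev_congr
          intro a _
          simp only [ctr]
          split_ifs <;> first | rfl | (exfalso; omega)
  · have e1 : j ≠ 0 := by omega
    have e2 : i ≠ 0 := by omega
    have e5 : j - 1 ≠ 0 := by omega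
    have e6 : i ≠ n + 1 + 1 := by omega
    by_cases h2 : j = n + 2
    · subst h2
      by_cases h3 : i = n + 1
      · subst h3
        simp only [cof, e2, if_false, if_true]
        simp [ctr, mul_assoc]
        congr 1
        apply ev_congr
        intro a ha
        simp [ctr, ha]
      · have : ¬ n < i - 1 := by omega
        have h4 : n ≠ i - 1 := by omega
        simp [cof, e2, h3, e6, ctr, this, h4]
    · have e3 : j - 1 ≠ n + 1 := by omega
      have e4 : j ≠ n + 1 + 1 := by omega
      have e7 : i ≠ n + 1 := by omega
      simp only [cof, e1, e2, e3, e4, e5, e6, e7, if_false]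
      apply ev_congr
      intro a _
      simp only [ctr]
      split_ifs <;> first
        | rfl
        | (exfalso; omega)
        | (subst_vars; simp only [mul_assoc])

theorem alt_sum_zero (N : ℕ) (a : ℕ → ℕ → Λ)
    (h : ∀ j ≤ N + 1, ∀ i < j, a j i = a i (j - 1)) :
    ∑ j ∈ Finset.range (N + 2), (-1 : k) ^ j •
      ∑ i ∈ Finset.range (N + 1), (-1 : k) ^ i • a j i = 0 := by
  simp only [Finset.smul_sum, smul_smul, ← pow_add]
  rw [← Finset.sum_product']
  refine Finset.sum_involution
    (fun p _ => if p.2 < p.1 then (p.2, p.1 - 1) else (p.2 + 1, p.1)) ?_ ?_ ?_ ?_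
  · rintro ⟨j, i⟩ hp
    simp only [Finset.mem_product, Finset.mem_range] at hp
    dsimp only
    split_ifs with hc
    · dsimp only
      rw [h j (by omega) i hc]
      have : j + i = (i + (j - 1)) + 1 := by omega
      rw [this, pow_succ]; simp
    · dsimp only
      rw [h (i + 1) (by omega) j (by omega)]
      have : i + 1 + j = (j + i) + 1 := by omega
      rw [this, pow_succ]; simp
  · rintro ⟨j, i⟩ hp _
    dsimp only
    split_ifs with hc <;> simp only [ne_eq, Prod.mk.injEq] <;> omega
  · rintro ⟨j, i⟩ hp
    simp only [Finset.mem_product, Finset.mem_range] at hp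
    dsimp only
    split_ifs with hc <;> simp only [Finset.mem_product, Finset.mem_range] <;> omega
  · rintro ⟨j, i⟩ hp
    simp only [Finset.mem_product, Finset.mem_range] at hp
    by_cases hc : i < j
    · have h1 : ¬ j - 1 < i := by omega
      simp only [hc, if_true, h1, if_false, Prod.mk.injEq, and_true]
      omega
    · have h1 : j < i + 1 := by omega
      simp only [hc, if_true, h1, if_false, Prod.mk.injEq, true_and]
      omega

theorem hd_hd {n : ℕ} (f : Coch k Λ n) : hd (n + 1) (hd n f) = 0 := by
  apply ev_ext
  intro v
  have e : ev (hd n f) = fun v =>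
      ∑ i ∈ Finset.range (n + 2), (-1 : k) ^ i • cof n i (ev f) v := funext (ev_hd f)
  rw [ev_hd, e]
  simp only [cof_sum (fun i => cof n i (ev f)) (fun i => (-1 : k) ^ i)]
  exact alt_sum_zero (n + 1) (fun j i => cof (n + 1) j (cof n i (ev f)) v)
    (fun j hj i hij => cof_cof f hij hj v)

theorem ev_cupC {i j n : ℕ} (h : i + j = n) (f' : Coch k Λ i) (f : Coch k Λ j) (v : ℕ → Λ) :
    ev (cupC h f' f) v = ev f' v * ev f (fun a => v (i + a)) := by
  simp [ev, cupC_apply]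

theorem hd_cupC {i j n : ℕ} (h : i + j = n) (f' : Coch k Λ i) (f : Coch k Λ j) :
    hd n (cupC h f' f) = cupC (show (i + 1) + j = n + 1 by omega) (hd i f') f +
      (-1 : k) ^ i • cupC (show i + (j + 1) = n + 1 by omega) f' (hd j f) := by
  subst h
  apply ev_ext
  intro v
  rw [ev_add, ev_smul, ev_cupC, ev_cupC, ev_hd, ev_hd, ev_hd]
  have h1 : ∀ a ≤ i, cof (i + j) a (ev (cupC rfl f' f)) v =
      cof i a (ev f') v * ev f (fun a => v (i + 1 + a)) := by
    intro a ha
    have e1 : a ≠ i + j + 1 := by omega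
    have e2 : a ≠ i + 1 := by omega
    by_cases h0 : a = 0
    · subst h0
      simp [cof, ev_cupC, mul_assoc, add_right_comm]
    · simp only [cof, h0, e1, e2, if_false, ev_cupC]
      congr 1
      apply ev_congr
      intro b _
      have : ¬ i + b < a - 1 := by omega
      have h4 : i + b ≠ a - 1 := by omega
      simp only [ctr, this, h4, if_false]
      congr 1; ring
  have h2 : ∀ a ≤ j, cof (i + j) (i + 1 + a) (ev (cupC rfl f' f)) v =
      ev f' v * cof j (a + 1) (ev f) (fun a => v (i + a)) := by
    intro a ha
    have e0 : i + 1 + a ≠ 0 := by omega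
    by_cases hj : a = j
    · subst hj
      have : i + 1 + a = i + a + 1 := by omega
      simp [cof, this, ev_cupC, mul_assoc]
    · have e1 : i + 1 + a ≠ i + j + 1 := by omega
      have e2 : a + 1 ≠ j + 1 := by omega
      simp only [cof, e0, e1, e2, if_false, ev_cupC, Nat.succ_ne_zero]
      congr 1
      · apply ev_congr
        intro b hb
        have : b < i + 1 + a - 1 := by omega
        simp only [ctr, if_pos this]
      · apply ev_congr
        intro b _
        simp only [ctr]
        split_ifs <;> first | rfl | (exfalso; omega)
  have h3 : cof i (i + 1) (ev f') v * ev f (fun a => v (i + 1 + a)) =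
      ev f' v * cof j 0 (ev f) (fun a => v (i + a)) := by
    simp [cof, mul_assoc, add_assoc, add_comm 1]
  rw [show i + j + 2 = (i + 1) + (j + 1) by omega, Finset.sum_range_add,
    Finset.sum_range_succ _ (i + 1), Finset.sum_range_succ' _ (j + 1), add_mul, mul_add,
    Finset.sum_mul, Finset.mul_sum, smul_add, smul_mul_assoc, h3]
  have h4 : ∑ x ∈ Finset.range (i + 1), (-1 : k) ^ x • cof (i + j) x (ev (cupC rfl f' f)) v =
      ∑ x ∈ Finset.range (i + 1), ((-1 : k) ^ x • cof i x (ev f') v) *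
        ev f (fun a => v (i + 1 + a)) := by
    refine Finset.sum_congr rfl fun a ha => ?_
    rw [h1 a (by simpa [Nat.lt_succ_iff] using ha), smul_mul_assoc]
  have h5 : ∑ x ∈ Finset.range (j + 1),
        (-1 : k) ^ (i + 1 + x) • cof (i + j) (i + 1 + x) (ev (cupC rfl f' f)) v =
      (-1 : k) ^ i • ∑ x ∈ Finset.range (j + 1),
        ev f' v * ((-1 : k) ^ (x + 1) • cof j (x + 1) (ev f) (fun a => v (i + a))) := by
    rw [Finset.smul_sum]
    refine Finset.sum_congr rfl fun a ha => ?_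
    rw [h2 a (by simpa [Nat.lt_succ_iff] using ha), mul_smul_comm, smul_smul, ← pow_add]
    congr 2; ring
  rw [h4, h5]
  simp only [pow_zero, one_smul, pow_succ, mul_neg, mul_one, neg_smul]
  abel

end Hochschild

/-! ### Quivers, paths and trajectories -/

section Quivers

/-- A quiver is simply laced if it has neither loops nor several arrows with the same source and
the same target. -/
class SimplyLaced (V : Type v) [Quiver.{r} V] : Prop where
  subsingleton_hom : ∀ x y : V, Subsingleton (x ⟶ y)
  isEmpty_loop : ∀ x : V, IsEmpty (x ⟶ x)

variable (V : Type v) [Quiver.{r} V]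

/-- A path of a quiver: its source, its target, and the path itself. -/
structure QPath where
  src : V
  tgt : V
  path : Quiver.Path src tgt

variable {V}

/-- The length of a path. -/
def QPath.length (ω : QPath V) : ℕ := ω.path.length

/-- The path of length one given by an arrow. -/
def QPath.ofArrow {x y : V} (a : x ⟶ y) : QPath V := ⟨x, y, a.toPath⟩

/-- The concatenation `ω'ω` of two paths: first `ω`, then `ω'`. -/
def QPath.concat (ω' ω : QPath V) (h : ω'.src = ω.tgt) : QPath V :=
  ⟨ω.src, ω'.tgt, ω.path.comp (ω'.path.cast h rfl)⟩

variable (V)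

/-- The set `CQ` of cycles: paths whose source and target agree (the vertices are included). -/
def CQ : Type max v r := { ω : QPath V // ω.src = ω.tgt }

/-- The set `DQ` of non cycles. -/
def DQ : Type max v r := { ω : QPath V // ω.src ≠ ω.tgt }

variable {V}

/-- Trajectories of duration `n` from `x` to `y`: finite sequences of vertices (waiting) and arrows
(moving), with `n` entries, such that successive entries are concatenated. The last
constructor applied is the leftmost entry of the sequence. -/
inductive Traj : V → V → ℕ → Type max v r
  | nil (x : V) : Traj x x 0
  | wait {x y : V} {n : ℕ} (τ : Traj x y n) : Traj x y (n + 1)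
  | move {x y z : V} {n : ℕ} (a : y ⟶ z) (τ : Traj x y n) : Traj x z (n + 1)

namespace Traj

/-- The path over which a trajectory lies: the product of its entries in the path algebra. -/
def path : ∀ {x y : V} {n : ℕ}, Traj x y n → Quiver.Path x y
  | _, _, _, nil _ => Quiver.Path.nil
  | _, _, _, wait τ => τ.path
  | _, _, _, move a τ => τ.path.cons a

/-- The sequence of vertices visited by a trajectory, starting at its target: the `i`-th entry
from the left (counted from `0`) goes from `vert (i + 1)` to `vert i`. -/
def vert : ∀ {x y : V} {n : ℕ}, Traj x y n → ℕ → V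
  | x, _, _, nil _, _ => x
  | _, y, _, wait _, 0 => y
  | _, _, _, wait τ, i + 1 => τ.vert i
  | _, _, _, move (z := z) _ _, 0 => z
  | _, _, _, move _ τ, i + 1 => τ.vert i

/-- `WaitIncr τ σ`: the trajectory `σ` is obtained from `τ` by increasing by one one of the
waiting times. -/
inductive WaitIncr : ∀ {x y : V} {n : ℕ}, Traj x y n → Traj x y (n + 1) → Prop
  | here {x y : V} {n : ℕ} (τ : Traj x y n) : WaitIncr τ (wait τ)
  | wait {x y : V} {n : ℕ} {τ : Traj x y n} {σ : Traj x y (n + 1)} (h : WaitIncr τ σ) :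
      WaitIncr (wait τ) (wait σ)
  | move {x y z : V} {n : ℕ} (a : y ⟶ z) {τ : Traj x y n} {σ : Traj x y (n + 1)}
      (h : WaitIncr τ σ) : WaitIncr (move a τ) (move a σ)

theorem WaitIncr.path_eq {x y : V} {n : ℕ} {τ : Traj x y n} {σ : Traj x y (n + 1)}
    (h : WaitIncr τ σ) : σ.path = τ.path := by
  induction h with
  | here => rfl
  | wait _ ih => simpa [path] using ih
  | move a _ ih => simp [path, ih]

theorem vert_zero {x y : V} {n : ℕ} (τ : Traj x y n) : τ.vert 0 = y := by
  cases τ <;> rfl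

theorem vert_last {x y : V} {n : ℕ} (τ : Traj x y n) : ∀ i, n ≤ i → τ.vert i = x := by
  induction τ with
  | nil => intros; rfl
  | wait τ ih =>
    intro i hi
    obtain ⟨i, rfl⟩ : ∃ j, i = j + 1 := ⟨i - 1, by omega⟩
    exact ih i (by omega)
  | move a τ ih =>
    intro i hi
    obtain ⟨i, rfl⟩ : ∃ j, i = j + 1 := ⟨i - 1, by omega⟩
    exact ih i (by omega)

theorem path_length_le {x y : V} {n : ℕ} (τ : Traj x y n) : τ.path.length ≤ n := by
  induction τ with
  | nil => simp [path]
  | wait τ ih => simp [path]; omega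
  | move a τ ih => simp [path]; omega

theorem vert_injective [SimplyLaced V] {x y : V} {n : ℕ} (τ σ : Traj x y n)
    (h : ∀ i ≤ n, τ.vert i = σ.vert i) : τ = σ := by
  induction τ with
  | nil => cases σ; rfl
  | @wait y n τ ih =>
    cases σ with
    | wait σ => rw [ih σ fun i hi => h (i + 1) (by omega)]
    | @move z _ _ a σ =>
      have := h 1 (by omega)
      simp only [vert, vert_zero] at this
      subst this
      exact ((SimplyLaced.isEmpty_loop y).false a).elim
  | @move z y n b τ ih =>
    cases σ with
    | wait σ =>
      have := h 1 (by omega)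
      simp only [vert, vert_zero] at this
      subst this
      exact ((SimplyLaced.isEmpty_loop _).false b).elim
    | @move z' _ _ a σ =>
      have := h 1 (by omega)
      simp only [vert, vert_zero] at this
      subst this
      rw [ih σ fun i hi => h (i + 1) (by omega), (SimplyLaced.subsingleton_hom _ _).elim a b]

theorem exists_of_vert (n : ℕ) : ∀ s : ℕ → V,
    (∀ i < n, s i = s (i + 1) ∨ Nonempty (s (i + 1) ⟶ s i)) →
    ∃ τ : Traj (s n) (s 0) n, ∀ i ≤ n, τ.vert i = s i := by
  induction n with
  | zero =>
    intro s _
    refine ⟨nil _, fun i hi => ?_⟩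
    obtain rfl : i = 0 := by omega
    rfl
  | succ n ih =>
    intro s hs
    obtain ⟨τ, hτ⟩ := ih (fun i => s (i + 1)) (fun i hi => hs (i + 1) (by omega))
    have h0 := hs 0 (by omega)
    rcases h0 with h0 | ⟨⟨a⟩⟩
    · have key : ∀ z, z = s 1 → ∃ σ : Traj (s (n + 1)) z (n + 1),
          σ.vert 0 = z ∧ ∀ i ≤ n, σ.vert (i + 1) = s (i + 1) := by
        rintro z rfl
        exact ⟨wait τ, rfl, hτ⟩
      obtain ⟨σ, h1, h2⟩ := key (s 0) h0
      refine ⟨σ, fun i hi => ?_⟩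
      rcases i with _ | i
      · exact h1
      · exact h2 i (by omega)
    · refine ⟨move a τ, fun i hi => ?_⟩
      rcases i with _ | i
      · rfl
      · exact hτ i (by omega)

theorem exists_mid (n : ℕ) : ∀ {x y : V} (σ : Traj x y (n + 1)) (i : ℕ), i < n →
    (∃ (z₁ z₂ z₃ : V) (_ : z₁ ⟶ z₂) (_ : z₂ ⟶ z₃),
      σ.vert (i + 2) = z₁ ∧ σ.vert (i + 1) = z₂ ∧ σ.vert i = z₃) ∨
    ∃ τ : Traj x y n, WaitIncr τ σ ∧
      ∀ j, τ.vert j = σ.vert (if j < i + 1 then j else j + 1) := by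
  induction n with
  | zero => intro x y σ i hi; omega
  | succ n ih =>
    intro x y σ i hi
    rcases i with _ | i
    · cases σ with
      | wait σ =>
        refine Or.inr ⟨σ, .here σ, fun j => ?_⟩
        rcases j with _ | j
        · exact vert_zero σ
        · simp [vert]
      | move a σ =>
        cases σ with
        | wait ρ =>
          refine Or.inr ⟨move a ρ, .move a (.here ρ), fun j => ?_⟩
          rcases j with _ | j
          · rfl
          · simp [vert]
        | move b ρ => exact Or.inl ⟨_, _, _, b, a, vert_zero ρ, rfl, rfl⟩
    · cases σ with
      | wait σ =>
        rcases ih σ i (by omega) with h | ⟨τ, h, h'⟩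
        · exact Or.inl h
        · refine Or.inr ⟨wait τ, .wait h, fun j => ?_⟩
          rcases j with _ | j
          · rfl
          · simp only [vert, h', Nat.add_lt_add_iff_right]
            split_ifs <;> rfl
      | move a σ =>
        rcases ih σ i (by omega) with h | ⟨τ, h, h'⟩
        · exact Or.inl h
        · refine Or.inr ⟨move a τ, .move a h, fun j => ?_⟩
          rcases j with _ | j
          · rfl
          · simp only [vert, h', Nat.add_lt_add_iff_right]
            split_ifs <;> rfl

theorem exists_right (n : ℕ) : ∀ {x y : V} (σ : Traj x y (n + 1)),
    (∃ τ : Traj x y n, WaitIncr τ σ ∧ ∀ j ≤ n, τ.vert j = σ.vert j) ∨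
    ∃ (x' : V) (a : x ⟶ x') (τ : Traj x' y n),
      σ.path = a.toPath.comp τ.path ∧ ∀ j ≤ n, τ.vert j = σ.vert j := by
  induction n with
  | zero =>
    intro x y σ
    cases σ with
    | wait σ =>
      refine Or.inl ⟨σ, .here σ, fun j hj => ?_⟩
      obtain rfl : j = 0 := by omega
      exact vert_zero σ
    | move a σ =>
      cases σ
      refine Or.inr ⟨_, a, nil _, rfl, fun j hj => ?_⟩
      obtain rfl : j = 0 := by omega
      rfl
  | succ n ih =>
    intro x y σ
    cases σ with
    | wait σ =>
      rcases ih σ with ⟨τ, h, h'⟩ | ⟨x', a, τ, h, h'⟩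
      · refine Or.inl ⟨wait τ, .wait h, fun j hj => ?_⟩
        rcases j with _ | j
        · rfl
        · exact h' j (by omega)
      · refine Or.inr ⟨x', a, wait τ, h, fun j hj => ?_⟩
        rcases j with _ | j
        · rfl
        · exact h' j (by omega)
    | move b σ =>
      rcases ih σ with ⟨τ, h, h'⟩ | ⟨x', a, τ, h, h'⟩
      · refine Or.inl ⟨move b τ, .move b h, fun j hj => ?_⟩
        rcases j with _ | j
        · rfl
        · exact h' j (by omega)
      · refine Or.inr ⟨x', a, move b τ, by simp [path, h], fun j hj => ?_⟩
        rcases j with _ | j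
        · rfl
        · exact h' j (by omega)

instance [Finite V] [SimplyLaced V] (x y : V) (n : ℕ) : Finite (Traj x y n) :=
  Finite.of_injective (fun (τ : Traj x y n) (i : Fin (n + 1)) => τ.vert i) fun τ σ h =>
    vert_injective τ σ fun i hi => congrFun h ⟨i, by omega⟩

end Traj

/-- The set `T_n(ω)` of trajectories of duration `n` over a path `ω`. -/
def TrajOver (ω : QPath V) (n : ℕ) : Type max v r :=
  { τ : Traj ω.src ω.tgt n // τ.path = ω.path }

noncomputable instance [Finite V] [SimplyLaced V] (ω : QPath V) (n : ℕ) :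
    Fintype (TrajOver ω n) :=
  @Fintype.ofFinite _ (Subtype.finite)

end Quivers

/-! ### Sets over a simply laced quiver and the associated algebra -/

/-- A `Q`-set whose bimodule maps are all zero: a `k`-algebra `A x` for each vertex `x` of the
quiver, and a non zero `A y`-`A x`-bimodule `M a` (over `k`) for each arrow `a : x ⟶ y`. The
associativity constraints on the bimodule maps `M b ⊗ M a → M c` hold trivially as
these maps are zero. -/
structure ZeroQSet (k : Type u) [Field k] (V : Type v) [Quiver.{r} V] where
  A : V → Type w
  M : ∀ {x y : V}, (x ⟶ y) → Type w
  [ringA : ∀ x, Ring (A x)]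
  [algebraA : ∀ x, Algebra k (A x)]
  [addCommGroupM : ∀ {x y : V} (a : x ⟶ y), AddCommGroup (M a)]
  [moduleM : ∀ {x y : V} (a : x ⟶ y), Module k (M a)]
  [leftM : ∀ {x y : V} (a : x ⟶ y), Module (A y) (M a)]
  [rightM : ∀ {x y : V} (a : x ⟶ y), Module (A x)ᵐᵒᵖ (M a)]
  [smulCommM : ∀ {x y : V} (a : x ⟶ y), SMulCommClass (A y) (A x)ᵐᵒᵖ (M a)]
  [towerLeftM : ∀ {x y : V} (a : x ⟶ y), IsScalarTower k (A y) (M a)]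
  [towerRightM : ∀ {x y : V} (a : x ⟶ y), IsScalarTower k (A x)ᵐᵒᵖ (M a)]
  [nontrivialM : ∀ {x y : V} (a : x ⟶ y), Nontrivial (M a)]

namespace ZeroQSet

attribute [instance] ringA algebraA addCommGroupM moduleM leftM rightM smulCommM towerLeftM
  towerRightM nontrivialM

variable {k : Type u} [Field k] {V : Type v} [Quiver.{r} V] (Δ : ZeroQSet.{u, v, w, r} k V)

/-- `M = ⊕_a M_a`, the sum over all the arrows (there are finitely many arrows in the finite simply
laced quivers considered below). -/
def Bimod : Type max v w r := ∀ (x y : V) (a : x ⟶ y), Δ.M a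

instance : AddCommGroup Δ.Bimod :=
  inferInstanceAs (AddCommGroup (∀ (x y : V) (a : x ⟶ y), Δ.M a))

instance : Module k Δ.Bimod :=
  inferInstanceAs (Module k (∀ (x y : V) (a : x ⟶ y), Δ.M a))

/-- The left action of `A = ×_x A_x` on `M`: on `M_a` it is the action of `A_{t(a)}`. -/
instance : Module (∀ x, Δ.A x) Δ.Bimod where
  smul b m := fun x y a => b y • m x y a
  one_smul m := by funext x y a; exact one_smul (Δ.A y) (m x y a)
  mul_smul b c m := by funext x y a; exact mul_smul (b y) (c y) (m x y a)
  smul_zero b := by funext x y a; exact smul_zero (M := Δ.A y) (A := Δ.M a) (b y)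
  smul_add b m m' := by funext x y a; exact smul_add (b y) (m x y a) (m' x y a)
  add_smul b c m := by funext x y a; exact add_smul (b y) (c y) (m x y a)
  zero_smul m := by funext x y a; exact zero_smul (Δ.A y) (m x y a)

/-- The right action of `A = ×_x A_x` on `M`: on `M_a` it is the action of `A_{s(a)}`. -/
instance : Module (∀ x, Δ.A x)ᵐᵒᵖ Δ.Bimod where
  smul b m := fun x y a => MulOpposite.op (b.unop x) • m x y a
  one_smul m := by funext x y a; exact one_smul (Δ.A x)ᵐᵒᵖ (m x y a)
  mul_smul b c m := by
    funext x y a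
    exact mul_smul (MulOpposite.op (b.unop x)) (MulOpposite.op (c.unop x)) (m x y a)
  smul_zero b := by
    funext x y a
    exact smul_zero (M := (Δ.A x)ᵐᵒᵖ) (A := Δ.M a) (MulOpposite.op (b.unop x))
  smul_add b m m' := by
    funext x y a; exact smul_add (MulOpposite.op (b.unop x)) (m x y a) (m' x y a)
  add_smul b c m := by
    funext x y a
    exact add_smul (MulOpposite.op (b.unop x)) (MulOpposite.op (c.unop x)) (m x y a)
  zero_smul m := by funext x y a; exact zero_smul (Δ.A x)ᵐᵒᵖ (m x y a)

theorem smul_apply (b : ∀ x, Δ.A x) (m : Δ.Bimod) (x y : V) (a : x ⟶ y) :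
    (b • m) x y a = b y • m x y a := rfl

theorem op_smul_apply (b : ∀ x, Δ.A x) (m : Δ.Bimod) (x y : V) (a : x ⟶ y) :
    (MulOpposite.op b • m) x y a = MulOpposite.op (b x) • m x y a := rfl

instance : SMulCommClass (∀ x, Δ.A x) (∀ x, Δ.A x)ᵐᵒᵖ Δ.Bimod where
  smul_comm b c m := by
    funext x y a; exact smul_comm (b y) (MulOpposite.op (c.unop x)) (m x y a)

instance : IsScalarTower k (∀ x, Δ.A x) Δ.Bimod where
  smul_assoc c b m := by funext x y a; exact smul_assoc c (b y) (m x y a)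

instance : IsScalarTower k (∀ x, Δ.A x)ᵐᵒᵖ Δ.Bimod where
  smul_assoc c b m := by
    funext x y a; exact smul_assoc c (MulOpposite.op (b.unop x)) (m x y a)

/-- The algebra `Λ_Δ = A ⊕ M`, with `M² = 0`. -/
abbrev Alg : Type max v w r := TrivSqZeroExt (∀ x, Δ.A x) Δ.Bimod

variable [DecidableEq V]

/-- The subalgebra `D = ×_x k` of `A ⊆ Λ_Δ`: the image of `c` is `∑_x c(x) e_x`. -/
def diag (c : V → k) : Δ.Alg := TrivSqZeroExt.inl fun x => algebraMap k (Δ.A x) (c x)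

/-- The idempotent `e_x`, that is the unit of `A_x`. -/
def e (x : V) : Δ.Alg := Δ.diag (Pi.single x 1)

end ZeroQSet

namespace ZeroQSet

section Cochains

variable {k : Type u} [Field k] {V : Type v} [Quiver.{r} V] (Δ : ZeroQSet.{u, v, w, r} k V)
theorem diag_mul (c c' : V → k) : Δ.diag c * Δ.diag c' = Δ.diag (c * c') := by
  simp only [diag, ← TrivSqZeroExt.inl_mul]
  congr 1
  funext x
  simp

/-- `J^n(Λ_Δ) = Hom_{D-D}(Λ^{⊗_D n}, Λ)`. The condition
`f(d₀x₁, …, dₙ₋₁xₙ) dₙ = d₀ f(x₁d₁, …, xₙdₙ)` for all `dᵢ ∈ D` says at once that `f` is balanced over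
`D` in each pair of consecutive variables and that it is a morphism of `D`-bimodules. For
`n = 0` it says that the element `f` of `Λ` commutes with `D`. -/
def J (n : ℕ) : Submodule k (Coch k Δ.Alg n) where
  carrier := { f | ∀ (c : Fin (n + 1) → V → k) (x : Fin n → Δ.Alg),
    f (fun i => Δ.diag (c i.castSucc) * x i) * Δ.diag (c (Fin.last n)) =
      Δ.diag (c 0) * f (fun i => x i * Δ.diag (c i.succ)) }
  add_mem' := by
    intro f g hf hg c x
    simp only [add_apply, add_mul, mul_add, hf c x, hg c x]
  zero_mem' := by intro c x; simp
  smul_mem' := by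
    intro a f hf c x
    simp only [_root_.smul_apply, smul_mul_assoc, mul_smul_comm, hf c x]

theorem ev_mem_J {n : ℕ} {f : Coch k Δ.Alg n} (hf : f ∈ Δ.J n) (c : ℕ → V → k)
    (v : ℕ → Δ.Alg) :
    ev f (fun i => Δ.diag (c i) * v i) * Δ.diag (c n) =
      Δ.diag (c 0) * ev f (fun i => v i * Δ.diag (c (i + 1))) :=
  hf (fun i => c i) (fun i => v i)

theorem mem_J_iff {n : ℕ} {f : Coch k Δ.Alg n} : f ∈ Δ.J n ↔
    ∀ (c : ℕ → V → k) (v : ℕ → Δ.Alg), ev f (fun i => Δ.diag (c i) * v i) * Δ.diag (c n) =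
      Δ.diag (c 0) * ev f (fun i => v i * Δ.diag (c (i + 1))) := by
  refine ⟨fun hf c v => Δ.ev_mem_J hf c v, fun h c x => ?_⟩
  have := h (fun i => if hi : i < n + 1 then c ⟨i, hi⟩ else 0)
    (fun i => if hi : i < n then x ⟨i, hi⟩ else 0)
  simp only [ev] at this
  convert this using 2
  · congr 1; funext i; simp [show (i : ℕ) < n + 1 by omega]; rfl
  · simp; rfl
  · simp
  · congr 1; funext i; simp; rfl

theorem hd_mem_J {n : ℕ} {f : Coch k Δ.Alg n} (hf : f ∈ Δ.J n) : hd n f ∈ Δ.J (n + 1) := by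
  have h1 : leftFace n f ∈ Δ.J (n + 1) := by
    rw [mem_J_iff] at *
    intro c v
    rw [ev_leftFace, ev_leftFace]
    have := hf (fun i => c (i + 1)) (fun i => v (i + 1))
    rw [mul_assoc, this]
    simp only [mul_assoc, zero_add]
  have h2 : rightFace n f ∈ Δ.J (n + 1) := by
    rw [mem_J_iff] at *
    intro c v
    rw [ev_rightFace, ev_rightFace]
    rw [← mul_assoc (ev f _), hf c v]
    simp only [mul_assoc]
  have h3 : ∀ i : Fin n, midFace i f ∈ Δ.J (n + 1) := by
    intro i
    rw [mem_J_iff] at *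
    intro c v
    rw [ev_midFace, ev_midFace]
    have := hf (fun j => if j < (i : ℕ) + 1 then c j else c (j + 1))
      (fun j => if j < (i : ℕ) then v j else if j = i then v j * Δ.diag (c (j + 1)) * v (j + 1)
        else v (j + 1))
    have e1 : ¬ n < (i : ℕ) + 1 := by omega
    simp only [e1, if_false, Nat.succ_pos, if_true] at this
    convert this using 2
    · apply ev_congr
      intro j _
      simp only [ctr]
      rcases lt_trichotomy j i with h | h | h
      · simp [h, show j < (i : ℕ) + 1 by omega]
      · simp [h, mul_assoc]
      · simp [show ¬ j < (i : ℕ) by omega, show ¬ j = (i : ℕ) by omega,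
          show ¬ j < (i : ℕ) + 1 by omega]
    · apply ev_congr
      intro j _
      simp only [ctr]
      rcases lt_trichotomy j i with h | h | h
      · simp [h]
      · simp [h, mul_assoc]
      · simp [show ¬ j < (i : ℕ) by omega, show ¬ j = (i : ℕ) by omega]
  rw [hd]
  simp only [LinearMap.add_apply, LinearMap.sum_apply, LinearMap.smul_apply]
  exact add_mem (add_mem h1 (sum_mem fun i _ => Submodule.smul_mem _ _ (h3 i)))
    (Submodule.smul_mem _ _ h2)

theorem cupC_mem_J {i j n : ℕ} (h : i + j = n) {f' : Coch k Δ.Alg i} {f : Coch k Δ.Alg j}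
    (hf' : f' ∈ Δ.J i) (hf : f ∈ Δ.J j) : cupC h f' f ∈ Δ.J n := by
  subst h
  rw [mem_J_iff] at *
  intro c v
  have h1 := hf' c v
  have h2 := hf (fun a => c (i + a)) (fun a => v (i + a))
  rw [ev_cupC, ev_cupC, mul_assoc, h2, ← mul_assoc, add_zero, h1, mul_assoc]
  rfl

variable [DecidableEq V]

theorem e_mul_self (x : V) : Δ.e x * Δ.e x = Δ.e x := by
  rw [e, diag_mul, ← Pi.single_mul, one_mul]

theorem e_mul_of_ne {x y : V} (h : x ≠ y) : Δ.e x * Δ.e y = 0 := by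
  rw [e, e, diag_mul]
  have : (Pi.single x 1 * Pi.single y 1 : V → k) = 0 := by
    funext z
    by_cases hz : z = x
    · subst hz; simp [h]
    · simp [hz]
  rw [this]
  ext <;> simp [diag]

theorem sum_e [Fintype V] : ∑ x, Δ.e x = 1 := by
  have h : ∀ x, Δ.e x = TrivSqZeroExt.inl (fun y => algebraMap k (Δ.A y)
    ((Pi.single x 1 : V → k) y)) := fun _ => rfl
  simp only [h]
  rw [← TrivSqZeroExt.inl_sum]
  have : (∑ x, fun y => algebraMap k (Δ.A y) ((Pi.single x 1 : V → k) y)) = 1 := by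
    funext y
    simp only [Finset.sum_apply, Pi.one_apply]
    rw [Finset.sum_eq_single y]
    · simp
    · intro b _ hb; simp [Pi.single_eq_of_ne hb.symm]
    · simp
  rw [this]; rfl

theorem fst_e (x y : V) : (Δ.e x).fst y = algebraMap k (Δ.A y) (if y = x then 1 else 0) := by
  simp [e, diag, Pi.single_apply]

theorem snd_e (x : V) : (Δ.e x).snd = 0 := rfl

/-- The `A`-component of `e_y z e_x`. -/
theorem fst_e_mul_e (x y : V) (z : Δ.Alg) (p : V) :
    (Δ.e y * z * Δ.e x).fst p = if p = y ∧ p = x then z.fst p else 0 := by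
  simp only [TrivSqZeroExt.fst_mul, Pi.mul_apply, fst_e]
  by_cases h1 : p = y <;> by_cases h2 : p = x <;> simp [h1, h2]

/-- The `M`-component of `e_y z e_x`. -/
theorem snd_e_mul_e (x y : V) (z : Δ.Alg) {p q : V} (a : p ⟶ q) :
    (Δ.e y * z * Δ.e x).snd p q a = if q = y ∧ p = x then z.snd p q a else 0 := by
  simp only [TrivSqZeroExt.snd_mul, snd_e, smul_zero, zero_add, add_zero]
  rw [op_smul_apply, smul_apply, fst_e, fst_e]
  by_cases h1 : q = y <;> by_cases h2 : p = x <;> simp [h1, h2]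

/-- `e_y Λ e_x = 0` if `x ≠ y` and there is no arrow from `x` to `y`. -/
theorem e_mul_mul_e_eq_zero {x y : V} (h : y ≠ x) (h' : IsEmpty (x ⟶ y)) (z : Δ.Alg) :
    Δ.e y * z * Δ.e x = 0 := by
  apply TrivSqZeroExt.ext
  · funext p
    rw [fst_e_mul_e, if_neg (by rintro ⟨rfl, rfl⟩; exact h rfl)]; rfl
  · funext p q a
    rw [snd_e_mul_e, if_neg (by rintro ⟨rfl, rfl⟩; exact h'.false a)]; rfl

/-- The product of two elements of `M` is zero. -/
theorem e_mul_mul_e_mul_e_mul_e {x y z t : V} (h : x ≠ y) (h' : z ≠ t) (a b : Δ.Alg) :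
    (Δ.e x * a * Δ.e y) * (Δ.e z * b * Δ.e t) = 0 := by
  have h1 : (Δ.e x * a * Δ.e y).fst = 0 := by
    funext p
    rw [fst_e_mul_e, if_neg (by rintro ⟨rfl, rfl⟩; exact h rfl)]; rfl
  have h2 : (Δ.e z * b * Δ.e t).fst = 0 := by
    funext p
    rw [fst_e_mul_e, if_neg (by rintro ⟨rfl, rfl⟩; exact h' rfl)]; rfl
  apply TrivSqZeroExt.ext
  · rw [TrivSqZeroExt.fst_mul, h1, zero_mul]; rfl
  · rw [TrivSqZeroExt.snd_mul, h1, h2]; simp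

theorem e_assoc (x : V) (z : Δ.Alg) : Δ.e x * (Δ.e x * z) = Δ.e x * z := by
  rw [← mul_assoc, e_mul_self]

/-- The projection of cochains onto those supported on a trajectory `τ` with sequence of
vertices `s`: each variable `xᵢ` is replaced by its component
`e_{s i} xᵢ e_{s (i+1)}` in the algebra or bimodule given by the `i`-th entry of `τ` (recall that
`e_x Λ e_x = A_x`, and that `e_y Λ e_x = M_a` if `a : x ⟶ y` is an arrow), and the value of
the cochain is replaced by its component in `Δ_ω = e_{t(ω)} Λ e_{s(ω)}`. -/
def proj {n : ℕ} (s : ℕ → V) : Coch k Δ.Alg n →ₗ[k] Coch k Δ.Alg n where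
  toFun f := (LinearMap.mulLeft k (Δ.e (s 0)) ∘ₗ LinearMap.mulRight k (Δ.e (s n))).compMultilinearMap
    (f.compLinearMap fun i : Fin n =>
      LinearMap.mulRight k (Δ.e (s (i + 1))) ∘ₗ LinearMap.mulLeft k (Δ.e (s i)))
  map_add' f g := by
    refine MultilinearMap.ext fun v => ?_
    simp [add_mul, mul_add]
  map_smul' c f := by
    refine MultilinearMap.ext fun v => ?_
    simp

theorem ev_proj {n : ℕ} (s : ℕ → V) (f : Coch k Δ.Alg n) (v : ℕ → Δ.Alg) :
    ev (Δ.proj s f) v =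
      Δ.e (s 0) * (ev f (fun i => Δ.e (s i) * v i * Δ.e (s (i + 1))) * Δ.e (s n)) := rfl

theorem proj_congr {n : ℕ} {s s' : ℕ → V} (h : ∀ i ≤ n, s i = s' i) (f : Coch k Δ.Alg n) :
    Δ.proj s f = Δ.proj s' f := by
  apply ev_ext
  intro v
  rw [ev_proj, ev_proj, h 0 (by omega), h n le_rfl]
  congr 2
  apply ev_congr
  intro i hi
  rw [h i (by omega), h (i + 1) (by omega)]

theorem proj_proj {n : ℕ} (s : ℕ → V) (f : Coch k Δ.Alg n) :
    Δ.proj s (Δ.proj s f) = Δ.proj s f := by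
  apply ev_ext
  intro v
  simp only [ev_proj, mul_assoc, e_mul_self, e_assoc]

theorem proj_proj_of_ne {n : ℕ} {s s' : ℕ → V} {i : ℕ} (hi : i ≤ n) (h : s i ≠ s' i)
    (f : Coch k Δ.Alg n) : Δ.proj s (Δ.proj s' f) = 0 := by
  apply ev_ext
  intro v
  rw [ev_z, ev_proj, ev_proj]
  rcases i with _ | i
  · simp only [← mul_assoc, Δ.e_mul_of_ne h, zero_mul]
  · rw [ev_zero f i (by omega), zero_mul, mul_zero, zero_mul, mul_zero]
    simp only [mul_assoc, Δ.e_mul_of_ne h, mul_zero]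

theorem diag_comm_e (c : V → k) (x : V) : Δ.diag c * Δ.e x = Δ.e x * Δ.diag c := by
  rw [e, diag_mul, diag_mul, mul_comm]

theorem proj_mem_J {n : ℕ} (s : ℕ → V) {f : Coch k Δ.Alg n} (hf : f ∈ Δ.J n) :
    Δ.proj s f ∈ Δ.J n := by
  rw [mem_J_iff] at *
  intro c v
  have h := hf c (fun i => Δ.e (s i) * v i * Δ.e (s (i + 1)))
  have h1 : (fun i => Δ.e (s i) * (Δ.diag (c i) * v i) * Δ.e (s (i + 1))) =
      fun i => Δ.diag (c i) * (Δ.e (s i) * v i * Δ.e (s (i + 1))) := by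
    funext i; simp only [← mul_assoc, diag_comm_e]
  have h2 : (fun i => Δ.e (s i) * (v i * Δ.diag (c (i + 1))) * Δ.e (s (i + 1))) =
      fun i => (Δ.e (s i) * v i * Δ.e (s (i + 1))) * Δ.diag (c (i + 1)) := by
    funext i; simp only [mul_assoc, diag_comm_e]
  rw [ev_proj, ev_proj, h1, h2, mul_assoc, mul_assoc, ← diag_comm_e, ← mul_assoc (ev f _), h,
    ← mul_assoc, ← mul_assoc, ← diag_comm_e]
  simp only [mul_assoc]

/-! #### Compatibility of the projections with the faces -/

theorem proj_leftFace {n : ℕ} {s t : ℕ → V} (h : ∀ j ≤ n, t j = s (j + 1))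
    (f : Coch k Δ.Alg n) :
    Δ.proj s (leftFace n f) = Δ.proj s (leftFace n (Δ.proj t f)) := by
  apply ev_ext
  intro v
  simp only [ev_proj, ev_leftFace]
  have : ev f (fun i => Δ.e (t i) * (Δ.e (s (i + 1)) * v (i + 1) * Δ.e (s (i + 1 + 1))) *
      Δ.e (t (i + 1))) = ev f (fun j => Δ.e (s (j + 1)) * v (j + 1) * Δ.e (s (j + 1 + 1))) := by
    apply ev_congr
    intro i hi
    rw [h i (by omega), h (i + 1) (by omega)]
    simp only [mul_assoc, e_mul_self, e_assoc]
  rw [this, h 0 (by omega), h n le_rfl]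
  simp only [mul_assoc, e_mul_self, e_assoc, zero_add]

theorem proj_rightFace {n : ℕ} {s t : ℕ → V} (h : ∀ j ≤ n, t j = s j)
    (f : Coch k Δ.Alg n) :
    Δ.proj s (rightFace n f) = Δ.proj s (rightFace n (Δ.proj t f)) := by
  apply ev_ext
  intro v
  simp only [ev_proj, ev_rightFace]
  have : ev f (fun i => Δ.e (t i) * (Δ.e (s i) * v i * Δ.e (s (i + 1))) *
      Δ.e (t (i + 1))) = ev f (fun i => Δ.e (s i) * v i * Δ.e (s (i + 1))) := by
    apply ev_congr
    intro i hi
    rw [h i (by omega), h (i + 1) (by omega)]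
    simp only [mul_assoc, e_mul_self, e_assoc]
  rw [this, h 0 (by omega), h n le_rfl]
  simp only [mul_assoc, e_mul_self, e_assoc]

theorem proj_midFace {n : ℕ} (i : Fin n) {s t : ℕ → V}
    (h : ∀ j ≤ n, t j = s (if j < (i : ℕ) + 1 then j else j + 1)) (f : Coch k Δ.Alg n) :
    Δ.proj s (midFace i f) = Δ.proj s (midFace i (Δ.proj t f)) := by
  apply ev_ext
  intro v
  simp only [ev_proj, ev_midFace]
  have : ev f (fun j => Δ.e (t j) *
        ctr (i : ℕ) (fun i => Δ.e (s i) * v i * Δ.e (s (i + 1))) j * Δ.e (t (j + 1))) =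
      ev f (ctr (i : ℕ) (fun i => Δ.e (s i) * v i * Δ.e (s (i + 1)))) := by
    apply ev_congr
    intro j hj
    rw [h j (by omega), h (j + 1) (by omega)]
    simp only [ctr]
    rcases lt_trichotomy j i with h | h | h
    · simp [h, show j < (i : ℕ) + 1 by omega, mul_assoc, e_mul_self, e_assoc]
    · simp [h, mul_assoc, e_mul_self, e_assoc]
    · simp [show ¬ j < (i : ℕ) by omega, show ¬ j = (i : ℕ) by omega,
          show ¬ j < (i : ℕ) + 1 by omega, mul_assoc, e_mul_self, e_assoc]
  rw [this, h 0 (by omega), h n le_rfl]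
  simp [show ¬ n < (i : ℕ) + 1 by omega, mul_assoc, e_mul_self, e_assoc]

theorem proj_midFace_eq_zero {n : ℕ} (i : Fin n) {s : ℕ → V} (h₁ : s i ≠ s (i + 1))
    (h₂ : s (i + 1) ≠ s (i + 2)) (f : Coch k Δ.Alg n) : Δ.proj s (midFace i f) = 0 := by
  apply ev_ext
  intro v
  rw [ev_proj, ev_midFace, ev_z, ev_zero f i i.2, zero_mul, mul_zero]
  simp only [ctr, lt_irrefl, if_false, if_true]
  exact Δ.e_mul_mul_e_mul_e_mul_e h₁ h₂ _ _

/-- If the component of `hd f` at `σ` is computed from components of `f` which vanish, it is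
zero. -/
theorem proj_hd_eq_zero [SimplyLaced V] {n : ℕ} {x y : V} (σ : Traj x y (n + 1))
    (f : Coch k Δ.Alg n)
    (h₁ : ∀ τ : Traj x y n, Traj.WaitIncr τ σ → Δ.proj τ.vert f = 0)
    (h₂ : ∀ (y' : V) (a : y' ⟶ y) (τ : Traj x y' n), σ = Traj.move a τ →
      Δ.proj σ.vert (leftFace n (Δ.proj τ.vert f)) = 0)
    (h₃ : ∀ (x' : V) (a : x ⟶ x') (τ : Traj x' y n), σ.path = a.toPath.comp τ.path →
      Δ.proj σ.vert (rightFace n (Δ.proj τ.vert f)) = 0) :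
    Δ.proj σ.vert (hd n f) = 0 := by
  have hne : ∀ {x y : V}, (x ⟶ y) → y ≠ x := by
    rintro x y a rfl
    exact (SimplyLaced.isEmpty_loop y).false a
  have hl : Δ.proj σ.vert (leftFace n f) = 0 := by
    cases σ with
    | wait τ =>
      rw [Δ.proj_leftFace (t := τ.vert) (fun j _ => rfl), h₁ τ (.here τ), map_zero, map_zero]
    | move a τ => rw [Δ.proj_leftFace (t := τ.vert) (fun j _ => rfl), h₂ _ a τ rfl]
  have hr : Δ.proj σ.vert (rightFace n f) = 0 := by
    rcases Traj.exists_right n σ with ⟨τ, h, h'⟩ | ⟨x', a, τ, h, h'⟩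
    · rw [Δ.proj_rightFace h', h₁ τ h, map_zero, map_zero]
    · rw [Δ.proj_rightFace h', h₃ x' a τ h]
  have hm : ∀ i : Fin n, Δ.proj σ.vert (midFace i f) = 0 := by
    intro i
    rcases Traj.exists_mid n σ i i.2 with ⟨z₁, z₂, z₃, a, b, e₁, e₂, e₃⟩ | ⟨τ, h, h'⟩
    · refine Δ.proj_midFace_eq_zero i ?_ ?_ f
      · rw [e₂, e₃]; exact hne b
      · rw [e₁, e₂]; exact hne a
    · rw [Δ.proj_midFace i (fun j _ => h' j), h₁ τ h, map_zero, map_zero]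
  rw [hd]
  simp only [LinearMap.add_apply, LinearMap.sum_apply, LinearMap.smul_apply, map_add, map_sum,
    map_smul, hl, hr, hm, smul_zero, Finset.sum_const_zero, add_zero]

theorem eq_zero_of_proj [Fintype V] {n : ℕ} {f : Coch k Δ.Alg n} (hf : f ∈ Δ.J n)
    (h : ∀ (x y : V) (τ : Traj x y n), Δ.proj τ.vert f = 0) : f = 0 := by
  have key : ∀ s : ℕ → V, Δ.proj s f = 0 := by
    intro s
    by_cases hs : ∀ i < n, s i = s (i + 1) ∨ Nonempty (s (i + 1) ⟶ s i)
    · obtain ⟨τ, hτ⟩ := Traj.exists_of_vert n s hs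
      rw [← Δ.proj_congr hτ]
      exact h _ _ τ
    · push Not at hs
      obtain ⟨i, hi, h1, h2⟩ := hs
      apply ev_ext
      intro v
      rw [ev_proj, ev_zero f i hi, zero_mul, mul_zero, ev_z]
      exact Δ.e_mul_mul_e_eq_zero h1 (by simpa using h2) _
  have key2 : ∀ (s : ℕ → V) (v : ℕ → Δ.Alg),
      ev f (fun i => Δ.e (s i) * v i) * Δ.e (s n) = 0 := by
    intro s v
    have h1 := Δ.ev_mem_J hf (fun i => Pi.single (s i) 1) v
    have h2 := Δ.ev_mem_J hf (fun i => Pi.single (s i) 1) (fun i => v i * Δ.e (s (i + 1)))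
    have h3 := congrArg (fun g => ev g v) (key s)
    simp only [ev_proj, ev_z] at h3
    change ev f (fun i => Δ.e (s i) * v i) * Δ.e (s n) = Δ.e (s 0) * _ at h1
    change ev f (fun i => Δ.e (s i) * (v i * Δ.e (s (i + 1)))) * Δ.e (s n) = Δ.e (s 0) *
      ev f (fun i => v i * Δ.e (s (i + 1)) * Δ.e (s (i + 1))) at h2
    simp only [mul_assoc, e_mul_self] at h2 h3
    rw [h2, e_assoc] at h3
    rw [h1]
    exact h3
  ext1 x
  have h1 : x = fun i => ∑ p : V, Δ.e p * x i := by
    funext i; rw [← Finset.sum_mul, sum_e, one_mul]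
  rw [h1, MultilinearMap.map_sum, ← mul_one (∑ _, _), ← Δ.sum_e, Finset.sum_mul]
  refine Finset.sum_eq_zero fun p _ => ?_
  rw [Finset.mul_sum]
  refine Finset.sum_eq_zero fun q _ => ?_
  have := key2 (fun i => if hi : i < n then p ⟨i, hi⟩ else q)
    (fun i => if hi : i < n then x ⟨i, hi⟩ else 0)
  simpa [ev] using this

end Cochains

end ZeroQSet

namespace ZeroQSet

section Along

variable {k : Type u} [Field k] {V : Type v} [Quiver.{r} V] (Δ : ZeroQSet.{u, v, w, r} k V)
variable [DecidableEq V]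

/-- The space `J_τ = Hom_k(τ_Δ, Δ_ω)` of cochains over a trajectory `τ`, as a direct summand of
`J^n(Λ_Δ)` by extending by zero. -/
def JTraj {x y : V} {n : ℕ} (τ : Traj x y n) : Submodule k (Coch k Δ.Alg n) where
  carrier := { f | f ∈ Δ.J n ∧ Δ.proj τ.vert f = f }
  add_mem' := by
    rintro f g ⟨hf, hf'⟩ ⟨hg, hg'⟩
    exact ⟨add_mem hf hg, by rw [map_add, hf', hg']⟩
  zero_mem' := ⟨zero_mem _, map_zero _⟩
  smul_mem' := by
    rintro a f ⟨hf, hf'⟩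
    exact ⟨Submodule.smul_mem _ _ hf, by rw [map_smul, hf']⟩

/-- The space `⊕_{τ ∈ T_n(ω)} J_τ` of `n`-cochains along a path `ω`. -/
def K (ω : QPath V) (n : ℕ) : Submodule k (Coch k Δ.Alg n) :=
  ⨆ τ : TrajOver ω n, Δ.JTraj τ.1

/-- The non cycle subspace `D^n = ⊕_{δ ∈ DQ} J_δ^n` of `J^n`. -/
def D (n : ℕ) : Submodule k (Coch k Δ.Alg n) := ⨆ δ : DQ V, Δ.K δ.1 n

variable [Fintype V] [SimplyLaced V]

/-- The component along the path `ω` of a cochain. -/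
noncomputable def projPath (ω : QPath V) (n : ℕ) : Coch k Δ.Alg n →ₗ[k] Coch k Δ.Alg n :=
  ∑ τ : TrajOver ω n, Δ.proj τ.1.vert

open Classical in
/-- The coboundary of the complex of cochains along `ω`, on all cochains:
`f ↦ ∑_τ ∑_{σ ∈ τ₀⁺} (d f_τ)_σ`, where `τ` runs over `T_n(ω)` and `τ₀⁺` is the set of
trajectories obtained by increasing by one a waiting time of `τ`. -/
noncomputable def dPath (ω : QPath V) (n : ℕ) : Coch k Δ.Alg n →ₗ[k] Coch k Δ.Alg (n + 1) :=
  ∑ τ : TrajOver ω n,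
    ∑ σ ∈ (Finset.univ : Finset (TrajOver ω (n + 1))).filter (fun σ => Traj.WaitIncr τ.1 σ.1),
      Δ.proj σ.1.vert ∘ₗ hd n ∘ₗ Δ.proj τ.1.vert

theorem proj_proj_traj {x y : V} {n : ℕ} {σ τ : Traj x y n} (h : σ ≠ τ)
    (f : Coch k Δ.Alg n) : Δ.proj σ.vert (Δ.proj τ.vert f) = 0 := by
  have : ∃ i ≤ n, σ.vert i ≠ τ.vert i := by
    by_contra hc
    push Not at hc
    exact h (Traj.vert_injective σ τ hc)
  obtain ⟨i, hi, hne⟩ := this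
  exact Δ.proj_proj_of_ne hi hne f

theorem proj_proj_path {x y x' y' : V} {n : ℕ} {σ : Traj x y n} {τ : Traj x' y' n}
    (h : (⟨x, y, σ.path⟩ : QPath V) ≠ ⟨x', y', τ.path⟩) (f : Coch k Δ.Alg n) :
    Δ.proj σ.vert (Δ.proj τ.vert f) = 0 := by
  by_cases hx : x = x'
  · by_cases hy : y = y'
    · subst hx hy
      exact Δ.proj_proj_traj (by rintro rfl; exact h rfl) f
    · exact Δ.proj_proj_of_ne (i := 0) (by omega)
        (by rw [Traj.vert_zero, Traj.vert_zero]; exact hy) f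
  · exact Δ.proj_proj_of_ne (i := n) le_rfl
      (by rw [Traj.vert_last _ _ le_rfl, Traj.vert_last _ _ le_rfl]; exact hx) f

theorem projPath_apply (ω : QPath V) (n : ℕ) (f : Coch k Δ.Alg n) :
    Δ.projPath ω n f = ∑ τ : TrajOver ω n, Δ.proj τ.1.vert f := by
  simp [projPath]

theorem proj_projPath_self {ω : QPath V} {n : ℕ} (σ : TrajOver ω n) (f : Coch k Δ.Alg n) :
    Δ.proj σ.1.vert (Δ.projPath ω n f) = Δ.proj σ.1.vert f := by
  rw [projPath_apply, map_sum, Finset.sum_eq_single σ, proj_proj]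
  · intro τ _ h
    exact Δ.proj_proj_traj (fun e => h (Subtype.ext e.symm)) f
  · simp

theorem proj_projPath_mk {x y : V} {n : ℕ} (σ : Traj x y n) (f : Coch k Δ.Alg n) :
    Δ.proj σ.vert (Δ.projPath ⟨x, y, σ.path⟩ n f) = Δ.proj σ.vert f :=
  Δ.proj_projPath_self (ω := ⟨x, y, σ.path⟩) ⟨σ, rfl⟩ f

theorem proj_projPath_of_ne {ω : QPath V} {x y : V} {n : ℕ} {σ : Traj x y n}
    (h : (⟨x, y, σ.path⟩ : QPath V) ≠ ω) (f : Coch k Δ.Alg n) :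
    Δ.proj σ.vert (Δ.projPath ω n f) = 0 := by
  rw [projPath_apply, map_sum]
  refine Finset.sum_eq_zero fun τ _ => Δ.proj_proj_path ?_ f
  rw [τ.2]
  exact h

theorem projPath_projPath (ω : QPath V) (n : ℕ) (f : Coch k Δ.Alg n) :
    Δ.projPath ω n (Δ.projPath ω n f) = Δ.projPath ω n f := by
  rw [projPath_apply]
  simp only [proj_projPath_self]
  rw [projPath_apply]

theorem projPath_mem_K (ω : QPath V) {n : ℕ} {f : Coch k Δ.Alg n} (hf : f ∈ Δ.J n) :
    Δ.projPath ω n f ∈ Δ.K ω n := by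
  rw [projPath_apply]
  refine sum_mem fun τ _ => Submodule.mem_iSup_of_mem τ ⟨Δ.proj_mem_J _ hf, Δ.proj_proj _ f⟩

theorem mem_K {ω : QPath V} {n : ℕ} {f : Coch k Δ.Alg n} :
    f ∈ Δ.K ω n ↔ f ∈ Δ.J n ∧ Δ.projPath ω n f = f := by
  constructor
  · intro hf
    refine Submodule.iSup_induction (fun τ : TrajOver ω n => Δ.JTraj τ.1)
      (motive := fun f => f ∈ Δ.J n ∧ Δ.projPath ω n f = f) hf ?_ ⟨zero_mem _, map_zero _⟩ ?_
    · rintro τ f ⟨hf, hf'⟩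
      refine ⟨hf, ?_⟩
      rw [projPath_apply, Finset.sum_eq_single τ]
      · exact hf'
      · intro σ _ h
        rw [← hf']
        exact Δ.proj_proj_traj (fun e => h (Subtype.ext e)) f
      · simp
    · rintro f g ⟨hf, hf'⟩ ⟨hg, hg'⟩
      exact ⟨add_mem hf hg, by rw [map_add, hf', hg']⟩
  · rintro ⟨hf, hf'⟩
    rw [← hf']
    exact Δ.projPath_mem_K ω hf

theorem proj_of_mem_K {ω : QPath V} {x y : V} {n : ℕ} {σ : Traj x y n}
    (h : (⟨x, y, σ.path⟩ : QPath V) ≠ ω) {f : Coch k Δ.Alg n} (hf : f ∈ Δ.K ω n) :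
    Δ.proj σ.vert f = 0 := by
  rw [← (Δ.mem_K.1 hf).2]
  exact Δ.proj_projPath_of_ne h f

theorem projPath_of_mem_K_of_ne {ω ω' : QPath V} (h : ω' ≠ ω) {n : ℕ} {f : Coch k Δ.Alg n}
    (hf : f ∈ Δ.K ω n) : Δ.projPath ω' n f = 0 := by
  rw [projPath_apply]
  refine Finset.sum_eq_zero fun τ _ => Δ.proj_of_mem_K ?_ hf
  rw [τ.2]
  exact h

theorem dPath_mem_K (ω : QPath V) {n : ℕ} {f : Coch k Δ.Alg n} (hf : f ∈ Δ.J n) :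
    Δ.dPath ω n f ∈ Δ.K ω (n + 1) := by
  simp only [dPath, LinearMap.sum_apply, LinearMap.comp_apply]
  refine sum_mem fun τ _ => sum_mem fun σ _ => Submodule.mem_iSup_of_mem σ
    ⟨Δ.proj_mem_J _ (Δ.hd_mem_J (Δ.proj_mem_J _ hf)), Δ.proj_proj _ _⟩

theorem ne_of_length_ne {ω : QPath V} {x y : V} {p : Quiver.Path x y}
    (h : p.length ≠ ω.length) : (⟨x, y, p⟩ : QPath V) ≠ ω := by
  rintro rfl
  exact h rfl

/-- On cochains along `ω`, the coboundary `dPath` is the component along `ω` of the Hochschild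
coboundary. -/
theorem dPath_eq {ω : QPath V} {n : ℕ} {f : Coch k Δ.Alg n} (hf : f ∈ Δ.K ω n) :
    Δ.dPath ω n f = Δ.projPath ω (n + 1) (hd n f) := by
  classical
  have hL : Δ.dPath ω n f = ∑ σ : TrajOver ω (n + 1), ∑ τ : TrajOver ω n,
      Δ.proj σ.1.vert (hd n (if Traj.WaitIncr τ.1 σ.1 then Δ.proj τ.1.vert f else 0)) := by
    rw [Finset.sum_comm]
    simp only [dPath, LinearMap.sum_apply, LinearMap.comp_apply, Finset.sum_filter]
    refine Finset.sum_congr rfl fun τ _ => Finset.sum_congr rfl fun σ _ => ?_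
    split_ifs
    · rfl
    · simp
  rw [hL, projPath_apply]
  refine Finset.sum_congr rfl fun σ _ => ?_
  rw [← map_sum, ← map_sum, ← sub_eq_zero, ← map_sub, ← map_sub, ← neg_eq_zero, ← map_neg,
    ← map_neg, neg_sub]
  have hne : ∀ {x y : V} (τ : Traj x y n), τ.path.length ≠ ω.length →
      Δ.proj τ.vert (f - ∑ τ : TrajOver ω n,
        if Traj.WaitIncr τ.1 σ.1 then Δ.proj τ.1.vert f else 0) = 0 := by
    intro x y τ hτ
    rw [map_sub, Δ.proj_of_mem_K (ne_of_length_ne hτ) hf, zero_sub, neg_eq_zero, map_sum]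
    refine Finset.sum_eq_zero fun τ' _ => ?_
    split_ifs
    · refine Δ.proj_proj_path ?_ f
      rw [τ'.2]
      exact ne_of_length_ne hτ
    · exact map_zero _
  refine Δ.proj_hd_eq_zero σ.1 _ ?_ ?_ ?_
  · intro τ hτ
    rw [map_sub, map_sum, Finset.sum_eq_single ⟨τ, hτ.path_eq.symm.trans σ.2⟩]
    · rw [if_pos hτ, proj_proj, sub_self]
    · intro τ' _ h
      split_ifs
      · exact Δ.proj_proj_traj (fun e => h (Subtype.ext e.symm)) f
      · exact map_zero _
    · intro h
      exact absurd (Finset.mem_univ _) h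
  · intro y' a τ hτ
    rw [hne, map_zero, map_zero]
    have h1 : ω.length = τ.path.length + 1 := by
      rw [QPath.length, ← σ.2, hτ]; rfl
    omega
  · intro x' a τ hτ
    rw [hne, map_zero, map_zero]
    have h1 : ω.length = τ.path.length + 1 := by
      rw [QPath.length, ← σ.2, hτ, Quiver.Path.length_comp, Quiver.Path.length_toPath, add_comm]
    omega

/-- The Hochschild coboundary does not shorten paths. -/
theorem proj_hd_of_length_lt {ω : QPath V} {x y : V} {n : ℕ} {σ : Traj x y (n + 1)}
    (h : σ.path.length < ω.length) {f : Coch k Δ.Alg n} (hf : f ∈ Δ.K ω n) :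
    Δ.proj σ.vert (hd n f) = 0 := by
  refine Δ.proj_hd_eq_zero σ f ?_ ?_ ?_
  · intro τ hτ
    exact Δ.proj_of_mem_K (ne_of_length_ne (by rw [← hτ.path_eq]; omega)) hf
  · rintro y' a τ rfl
    rw [Δ.proj_of_mem_K (ne_of_length_ne _) hf, map_zero, map_zero]
    simp only [Traj.path, Quiver.Path.length_cons] at h
    omega
  · intro x' a τ hτ
    rw [Δ.proj_of_mem_K (ne_of_length_ne _) hf, map_zero, map_zero]
    rw [hτ, Quiver.Path.length_comp] at h
    omega

theorem dPath_dPath {ω : QPath V} {n : ℕ} {f : Coch k Δ.Alg n} (hf : f ∈ Δ.K ω n) :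
    Δ.dPath ω (n + 1) (Δ.dPath ω n f) = 0 := by
  rw [Δ.dPath_eq (Δ.dPath_mem_K ω (Δ.mem_K.1 hf).1), Δ.dPath_eq hf, projPath_apply]
  refine Finset.sum_eq_zero fun σ _ => ?_
  have key : Δ.proj σ.1.vert (hd (n + 1) (hd n f - Δ.projPath ω (n + 1) (hd n f))) = 0 := by
    refine Δ.proj_hd_eq_zero σ.1 _ ?_ ?_ ?_
    · intro τ hτ
      rw [map_sub, Δ.proj_projPath_self ⟨τ, hτ.path_eq.symm.trans σ.2⟩, sub_self]
    · intro y' a τ hτ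
      have h1 : ω.length = τ.path.length + 1 := by
        rw [QPath.length, ← σ.2, hτ]; rfl
      rw [map_sub, Δ.proj_projPath_of_ne (ne_of_length_ne (by omega)),
        Δ.proj_hd_of_length_lt (by omega) hf, sub_zero, map_zero, map_zero]
    · intro x' a τ hτ
      have h1 : ω.length = τ.path.length + 1 := by
        rw [QPath.length, ← σ.2, hτ, Quiver.Path.length_comp, Quiver.Path.length_toPath, add_comm]
      rw [map_sub, Δ.proj_projPath_of_ne (ne_of_length_ne (by omega)),
        Δ.proj_hd_of_length_lt (by omega) hf, sub_zero, map_zero, map_zero]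
  rw [map_sub, map_sub, hd_hd, map_zero, zero_sub, neg_eq_zero] at key
  exact key


/-- Along a non cycle, the Hochschild coboundary preserves the cochains. -/
theorem hd_of_non_cycle {δ : QPath V} (hδ : δ.src ≠ δ.tgt) {n : ℕ} {f : Coch k Δ.Alg n}
    (hf : f ∈ Δ.K δ n) : Δ.dPath δ n f = hd n f := by
  rw [Δ.dPath_eq hf, ← sub_eq_zero]
  have hJ := Δ.hd_mem_J (Δ.mem_K.1 hf).1
  refine Δ.eq_zero_of_proj (sub_mem (Δ.mem_K.1 (Δ.projPath_mem_K δ hJ)).1 hJ) ?_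
  intro x y σ
  have hloop : ∀ {x y : V}, (x ⟶ y) → y ≠ x := by
    rintro x y a rfl
    exact (SimplyLaced.isEmpty_loop y).false a
  by_cases h : (⟨x, y, σ.path⟩ : QPath V) = δ
  · subst h
    rw [map_sub, Δ.proj_projPath_mk, sub_self]
  · rw [map_sub, Δ.proj_projPath_of_ne h, zero_sub, neg_eq_zero]
    refine Δ.proj_hd_eq_zero σ f ?_ ?_ ?_
    · intro τ hτ
      exact Δ.proj_of_mem_K (by rwa [← hτ.path_eq]) hf
    · rintro y' a τ rfl
      by_cases h' : (⟨x, y', τ.path⟩ : QPath V) = δ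
      · subst h'
        apply ev_ext
        intro v
        rw [ev_proj, ev_leftFace, ev_proj, ev_z, Traj.vert_zero τ, Traj.vert_last τ n le_rfl]
        simp only [Traj.vert, Traj.vert_zero, zero_add]
        rw [← mul_assoc (Δ.e y'), Δ.e_mul_mul_e_mul_e_mul_e (hloop a) (Ne.symm hδ)]
        simp
      · rw [Δ.proj_of_mem_K h' hf, map_zero, map_zero]
    · intro x' a τ hτ
      by_cases h' : (⟨x', y, τ.path⟩ : QPath V) = δ
      · subst h'
        apply ev_ext
        intro v
        rw [ev_proj, ev_rightFace, ev_proj, ev_z, Traj.vert_zero τ, Traj.vert_last τ n le_rfl,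
          Traj.vert_last σ (n + 1) le_rfl, ← mul_assoc (Δ.e y)]
        by_cases hs : σ.vert n = x'
        · rw [hs, Δ.e_mul_mul_e_mul_e_mul_e (Ne.symm hδ) (hloop a)]
          simp
        · have := Δ.e_mul_of_ne (Ne.symm hs)
          simp only [mul_assoc]
          rw [← mul_assoc (Δ.e x'), this]
          simp
      · rw [Δ.proj_of_mem_K h' hf, map_zero, map_zero]

/-- The part of `hd f` over cycles, for `f` along a cycle `γ`, lies along `γ`. -/
theorem proj_hd_of_cycle {γ : QPath V} (hγ : γ.src = γ.tgt) {n : ℕ} {f : Coch k Δ.Alg n}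
    (hf : f ∈ Δ.K γ n) {x : V} (σ : Traj x x (n + 1)) :
    Δ.proj σ.vert (hd n f - Δ.dPath γ n f) = 0 := by
  have hloop : ∀ {x y : V}, (x ⟶ y) → y ≠ x := by
    rintro x y a rfl
    exact (SimplyLaced.isEmpty_loop y).false a
  rw [Δ.dPath_eq hf]
  by_cases h : (⟨x, x, σ.path⟩ : QPath V) = γ
  · subst h
    rw [map_sub, Δ.proj_projPath_mk, sub_self]
  · rw [map_sub, Δ.proj_projPath_of_ne h, sub_zero]
    refine Δ.proj_hd_eq_zero σ f ?_ ?_ ?_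
    · intro τ hτ
      exact Δ.proj_of_mem_K (by rwa [← hτ.path_eq]) hf
    · intro y' a τ _
      rw [Δ.proj_of_mem_K _ hf, map_zero, map_zero]
      rintro rfl
      exact hloop a hγ
    · intro x' a τ _
      rw [Δ.proj_of_mem_K _ hf, map_zero, map_zero]
      rintro rfl
      exact hloop a hγ

theorem mem_D {n : ℕ} {f : Coch k Δ.Alg n} :
    f ∈ Δ.D n ↔ f ∈ Δ.J n ∧ ∀ (x : V) (τ : Traj x x n), Δ.proj τ.vert f = 0 := by
  constructor
  · intro hf
    refine Submodule.iSup_induction (fun δ : DQ V => Δ.K δ.1 n)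
      (motive := fun f => f ∈ Δ.J n ∧ ∀ (x : V) (τ : Traj x x n), Δ.proj τ.vert f = 0)
      hf ?_ ⟨zero_mem _, fun _ _ => map_zero _⟩ ?_
    · intro δ f hf
      refine ⟨(Δ.mem_K.1 hf).1, fun x τ => Δ.proj_of_mem_K ?_ hf⟩
      intro h
      exact δ.2 (by rw [← h])
    · rintro f g ⟨hf, hf'⟩ ⟨hg, hg'⟩
      exact ⟨add_mem hf hg, fun x τ => by rw [map_add, hf', hg', add_zero]⟩
  · rintro ⟨hf, hf'⟩
    have (x y : V) : Fintype (Traj x y n) := Fintype.ofFinite _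
    have hsum : f = ∑ x : V, ∑ y : V, ∑ τ : Traj x y n, Δ.proj τ.vert f := by
      rw [← sub_eq_zero]
      refine Δ.eq_zero_of_proj (sub_mem hf (sum_mem fun x _ => sum_mem fun y _ =>
        sum_mem fun τ _ => Δ.proj_mem_J _ hf)) fun x y σ => ?_
      rw [map_sub, map_sum, Finset.sum_eq_single x, map_sum, Finset.sum_eq_single y, map_sum,
        Finset.sum_eq_single σ, proj_proj, sub_self]
      · intro τ _ h
        exact Δ.proj_proj_traj h.symm f
      · intro h
        exact absurd (Finset.mem_univ _) h
      · intro y' _ h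
        rw [map_sum]
        refine Finset.sum_eq_zero fun τ _ => Δ.proj_proj_path ?_ f
        intro e
        exact h (congrArg QPath.tgt e).symm
      · intro h
        exact absurd (Finset.mem_univ _) h
      · intro x' _ h
        rw [map_sum]
        refine Finset.sum_eq_zero fun y' _ => ?_
        rw [map_sum]
        refine Finset.sum_eq_zero fun τ _ => Δ.proj_proj_path ?_ f
        intro e
        exact h (congrArg QPath.src e).symm
      · intro h
        exact absurd (Finset.mem_univ _) h
    rw [hsum]
    refine sum_mem fun x _ => sum_mem fun y _ => sum_mem fun τ _ => ?_
    by_cases h : x = y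
    · subst h
      rw [hf' x τ]
      exact zero_mem _
    · refine Submodule.mem_iSup_of_mem (⟨⟨x, y, τ.path⟩, h⟩ : DQ V)
        (Submodule.mem_iSup_of_mem (⟨τ, rfl⟩ : TrajOver (⟨x, y, τ.path⟩ : QPath V) n)
          ⟨Δ.proj_mem_J _ hf, Δ.proj_proj _ f⟩)

theorem K_le_J (ω : QPath V) (n : ℕ) : Δ.K ω n ≤ Δ.J n := fun _ hf => (Δ.mem_K.1 hf).1

theorem K_le_D (δ : DQ V) (n : ℕ) : Δ.K δ.1 n ≤ Δ.D n := le_iSup (fun δ : DQ V => Δ.K δ.1 n) δ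

theorem D_le_J (n : ℕ) : Δ.D n ≤ Δ.J n := fun _ hf => (Δ.mem_D.1 hf).1

theorem hd_mem_D {n : ℕ} {f : Coch k Δ.Alg n} (hf : f ∈ Δ.D n) : hd n f ∈ Δ.D (n + 1) := by
  refine Submodule.iSup_induction (fun δ : DQ V => Δ.K δ.1 n)
    (motive := fun f => hd n f ∈ Δ.D (n + 1)) hf ?_ (by rw [map_zero]; exact zero_mem _) ?_
  · intro δ f hf
    rw [← Δ.hd_of_non_cycle δ.2 hf]
    exact Δ.K_le_D δ _ (Δ.dPath_mem_K _ (Δ.K_le_J _ _ hf))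
  · intro f g hf hg
    rw [map_add]
    exact add_mem hf hg

theorem hd_sub_dPath_mem_D {γ : QPath V} (hγ : γ.src = γ.tgt) {n : ℕ} {f : Coch k Δ.Alg n}
    (hf : f ∈ Δ.K γ n) : hd n f - Δ.dPath γ n f ∈ Δ.D (n + 1) :=
  Δ.mem_D.2 ⟨sub_mem (Δ.hd_mem_J (Δ.K_le_J _ _ hf))
    (Δ.K_le_J _ _ (Δ.dPath_mem_K _ (Δ.K_le_J _ _ hf))), fun _ σ => Δ.proj_hd_of_cycle hγ hf σ⟩

theorem projPath_hd_of_mem_D (δ : DQ V) {n : ℕ} {f : Coch k Δ.Alg n} (hf : f ∈ Δ.D n) :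
    Δ.dPath δ.1 n (Δ.projPath δ.1 n f) = Δ.projPath δ.1 (n + 1) (hd n f) := by
  refine Submodule.iSup_induction (fun δ : DQ V => Δ.K δ.1 n)
    (motive := fun f => Δ.dPath δ.1 n (Δ.projPath δ.1 n f) = Δ.projPath δ.1 (n + 1) (hd n f))
    hf ?_ (by simp) ?_
  · intro δ' f hf
    by_cases h : δ = δ'
    · subst h
      rw [(Δ.mem_K.1 hf).2, Δ.dPath_eq hf]
    · have h' : δ.1 ≠ δ'.1 := fun e => h (Subtype.ext e)
      rw [Δ.projPath_of_mem_K_of_ne h' hf, map_zero, ← Δ.hd_of_non_cycle δ'.2 hf,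
        Δ.projPath_of_mem_K_of_ne h' (Δ.dPath_mem_K _ (Δ.K_le_J _ _ hf))]
  · intro f g hf hg
    simp only [map_add, hf, hg]

end Along

end ZeroQSet

/-! ### The complexes of cochains -/

namespace ZeroQSet

section Complexes

variable {k : Type u} [Field k] {V : Type v} [Quiver.{r} V] (Δ : ZeroQSet.{u, v, w, r} k V)

instance (Λ : Type w) [Ring Λ] [Algebra k Λ] (n : ℕ) (U : Submodule k (Coch k Λ n)) :
    AddCommGroup U := Submodule.addCommGroup U

/-- The complex `J^•(Λ_Δ)`, with the Hochschild coboundary. -/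
noncomputable def Jcx : CochainComplex (ModuleCat.{max v w r} k) ℕ :=
  CochainComplex.of (fun n => ModuleCat.of k (Δ.J n))
    (fun n => ModuleCat.ofHom ((hd n).restrict fun _ hf => Δ.hd_mem_J hf))
    (fun n => by
      refine ModuleCat.hom_ext (LinearMap.ext fun f => ?_)
      exact Subtype.ext (hd_hd (Subtype.val f)))

variable [DecidableEq V] [Fintype V] [SimplyLaced V]

/-- The complex `(K_ω^•, 𝖽)` of cochains along a path `ω`. -/
noncomputable def Kcx (ω : QPath V) : CochainComplex (ModuleCat.{max v w r} k) ℕ :=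
  CochainComplex.of (fun n => ModuleCat.of k (Δ.K ω n))
    (fun n => ModuleCat.ofHom
      ((Δ.dPath ω n).restrict fun _ hf => Δ.dPath_mem_K ω (Δ.K_le_J ω n hf)))
    (fun n => by
      refine ModuleCat.hom_ext (LinearMap.ext fun f => ?_)
      exact Subtype.ext (Δ.dPath_dPath f.2))

/-- The cohomology `H^n_ω(Δ)` of `Δ` along the path `ω`. -/
noncomputable abbrev H (ω : QPath V) (n : ℕ) : ModuleCat.{max v w r} k := (Δ.Kcx ω).homology n

/-- The non cycle subcomplex `D^•` of `J^•`. -/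
noncomputable def Dcx : CochainComplex (ModuleCat.{max v w r} k) ℕ :=
  CochainComplex.of (fun n => ModuleCat.of k (Δ.D n))
    (fun n => ModuleCat.ofHom ((hd n).restrict fun _ hf => Δ.hd_mem_D hf))
    (fun n => by
      refine ModuleCat.hom_ext (LinearMap.ext fun f => ?_)
      exact Subtype.ext (hd_hd (Subtype.val f)))

/-- `D^n` as a subspace of `J^n`. -/
abbrev DinJ (n : ℕ) : Submodule k (Δ.J n) := (Δ.D n).submoduleOf (Δ.J n)

/-- The quotient complex `(J/D)^•`. -/
noncomputable def Qcx : CochainComplex (ModuleCat.{max v w r} k) ℕ :=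
  CochainComplex.of (fun n => ModuleCat.of k (Δ.J n ⧸ Δ.DinJ n))
    (fun n => ModuleCat.ofHom
      (Submodule.mapQ (Δ.DinJ n) (Δ.DinJ (n + 1))
        ((hd n).restrict fun _ hf => Δ.hd_mem_J hf) fun _ hf => Δ.hd_mem_D hf))
    (fun n => by
      refine ModuleCat.hom_ext (Submodule.linearMap_qext _ (LinearMap.ext fun f => ?_))
      exact congrArg (Submodule.Quotient.mk (p := Δ.DinJ (n + 2)))
        (Subtype.ext (hd_hd (Subtype.val f))))

/-- The inclusion `D^• → J^•`. -/
noncomputable def DtoJ : Δ.Dcx ⟶ Δ.Jcx :=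
  CochainComplex.ofHom
    (fun n => ModuleCat.ofHom (Submodule.inclusion (Δ.D_le_J n)))
    (fun n => by
      refine ModuleCat.hom_ext (LinearMap.ext fun f => ?_)
      simp only [Dcx, Jcx, CochainComplex.of_d]
      rfl)

/-- The projection `J^• → (J/D)^•`. -/
noncomputable def JtoQ : Δ.Jcx ⟶ Δ.Qcx :=
  CochainComplex.ofHom
    (fun n => ModuleCat.ofHom (Submodule.mkQ (Δ.DinJ n)))
    (fun n => by
      refine ModuleCat.hom_ext (LinearMap.ext fun f => ?_)
      simp only [Qcx, Jcx, CochainComplex.of_d]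
      rfl)

/-- For a non cycle `δ`, the inclusion of the complex of cochains along `δ` in `D^•`. -/
noncomputable def KtoD (δ : DQ V) : Δ.Kcx δ.1 ⟶ Δ.Dcx :=
  CochainComplex.ofHom
    (fun n => ModuleCat.ofHom (Submodule.inclusion (Δ.K_le_D δ n)))
    (fun n => by
      refine ModuleCat.hom_ext (LinearMap.ext fun f => ?_)
      simp only [Dcx, Kcx, CochainComplex.of_d]
      exact Subtype.ext (Δ.hd_of_non_cycle δ.2 f.2).symm)

/-- For a cycle `γ`, the inclusion of the complex of cochains along `γ` in `(J/D)^•`. -/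
noncomputable def KtoQ (γ : CQ V) : Δ.Kcx γ.1 ⟶ Δ.Qcx :=
  CochainComplex.ofHom
    (fun n => ModuleCat.ofHom
      (Submodule.mkQ (Δ.DinJ n) ∘ₗ Submodule.inclusion (Δ.K_le_J γ.1 n)))
    (fun n => by
      refine ModuleCat.hom_ext (LinearMap.ext fun f => ?_)
      simp only [Qcx, Kcx, CochainComplex.of_d]
      exact (Submodule.Quotient.eq _).2 (Δ.hd_sub_dPath_mem_D γ.2 f.2))

/-- The exact sequence of complexes `0 → D^• → J^• → (J/D)^• → 0`. -/
noncomputable def ses : ShortComplex (CochainComplex (ModuleCat.{max v w r} k) ℕ) :=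
  ShortComplex.mk Δ.DtoJ Δ.JtoQ (by
    ext n f
    exact (Submodule.Quotient.mk_eq_zero _).2 f.2)

theorem ses_shortExact : Δ.ses.ShortExact := by
  refine HomologicalComplex.shortExact_of_degreewise_shortExact _ fun n => ?_
  have hm : Mono (Δ.ses.map (HomologicalComplex.eval _ _ n)).f :=
    (ModuleCat.mono_iff_injective _).2 (Submodule.inclusion_injective (Δ.D_le_J n))
  have he : Epi (Δ.ses.map (HomologicalComplex.eval _ _ n)).g :=
    (ModuleCat.epi_iff_surjective _).2 (Submodule.mkQ_surjective (Δ.DinJ n))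
  refine ShortComplex.ShortExact.mk ?_
  rw [ShortComplex.moduleCat_exact_iff]
  intro f hf
  exact ⟨⟨f.1, (Submodule.Quotient.mk_eq_zero (Δ.DinJ n)).1 hf⟩, rfl⟩

/-- The projection of `D^•` on the complex of cochains along a non cycle. -/
noncomputable def DtoK (δ : DQ V) : Δ.Dcx ⟶ Δ.Kcx δ.1 :=
  CochainComplex.ofHom
    (fun n => ModuleCat.ofHom
      ((Δ.projPath δ.1 n).restrict fun _ hf => Δ.projPath_mem_K δ.1 (Δ.D_le_J n hf)))
    (fun n => by
      refine ModuleCat.hom_ext (LinearMap.ext fun f => ?_)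
      simp only [Dcx, Kcx, CochainComplex.of_d]
      exact Subtype.ext (Δ.projPath_hd_of_mem_D δ f.2))

theorem KtoD_DtoK (δ : DQ V) : Δ.KtoD δ ≫ Δ.DtoK δ = 𝟙 _ := by
  ext n f
  exact Subtype.ext (Δ.mem_K.1 f.2).2

theorem KtoD_DtoK_of_ne {δ δ' : DQ V} (h : δ ≠ δ') : Δ.KtoD δ ≫ Δ.DtoK δ' = 0 := by
  ext n f
  exact Subtype.ext (Δ.projPath_of_mem_K_of_ne (fun e => h (Subtype.ext e.symm)) f.2)

/-- The canonical map `⊕_{δ ∈ DQ} H^n_δ(Δ) → H^n(D^•)`. -/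
noncomputable def sumHtoD (n : ℕ) : (⨁ δ : DQ V, Δ.H δ.1 n) →ₗ[k] Δ.Dcx.homology n := by
  classical
  exact DirectSum.toModule k (DQ V) _
    fun δ => (HomologicalComplex.homologyMap (Δ.KtoD δ) n).hom

/-- The canonical map `⊕_{γ ∈ CQ} H^n_γ(Δ) → H^n((J/D)^•)`. -/
noncomputable def sumHtoQ (n : ℕ) : (⨁ γ : CQ V, Δ.H γ.1 n) →ₗ[k] Δ.Qcx.homology n := by
  classical
  exact DirectSum.toModule k (CQ V) _
    fun γ => (HomologicalComplex.homologyMap (Δ.KtoQ γ) n).hom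

end Complexes

end ZeroQSet

/-! ### Cohomology classes of cocycles -/

section Classes

variable {k : Type u} [Field k]

/-- The class of a cocycle of a cochain complex of vector spaces. -/
noncomputable def cls (C : CochainComplex (ModuleCat.{v} k) ℕ) (n : ℕ) :
    LinearMap.ker (C.d n (n + 1)).hom →ₗ[k] C.homology n :=
  (C.liftCycles (ModuleCat.ofHom (LinearMap.ker (C.d n (n + 1)).hom).subtype) (n + 1)
    (by simp) (by ext x; exact x.2) ≫ C.homologyπ n).hom

theorem cls_surjective (C : CochainComplex (ModuleCat.{v} k) ℕ) (n : ℕ) :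
    Function.Surjective (cls C n) := by
  intro x
  obtain ⟨z, rfl⟩ := (ModuleCat.epi_iff_surjective (C.homologyπ n)).1 inferInstance x
  have hz : (C.iCycles n) z ∈ LinearMap.ker (C.d n (n + 1)).hom := by
    have := C.iCycles_d n (n + 1)
    exact congrArg (fun f => f.hom z) this
  refine ⟨⟨_, hz⟩, ?_⟩
  rw [cls, ModuleCat.hom_comp, LinearMap.comp_apply]
  congr 1
  apply (ModuleCat.mono_iff_injective (C.iCycles n)).1 inferInstance
  exact congrArg (fun f => f.hom (⟨_, hz⟩ : LinearMap.ker (C.d n (n + 1)).hom))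
    (C.liftCycles_i (ModuleCat.ofHom (LinearMap.ker (C.d n (n + 1)).hom).subtype) (n + 1)
      (by simp) (by ext x; exact x.2))

theorem cls_eq_zero_iff (C : CochainComplex (ModuleCat.{v} k) ℕ) (n m : ℕ)
    (hm : (ComplexShape.up ℕ).prev n = m) (z : LinearMap.ker (C.d n (n + 1)).hom) :
    cls C n z = 0 ↔ ∃ y : C.X m, (C.d m n).hom y = z.1 := by
  have hi : ∀ z : LinearMap.ker (C.d n (n + 1)).hom, (C.iCycles n).hom
      ((C.liftCycles (ModuleCat.ofHom (LinearMap.ker (C.d n (n + 1)).hom).subtype) (n + 1)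
        (by simp) (by ext x; exact x.2)).hom z) = z.1 := fun z =>
    congrArg (fun f => f.hom z)
      (C.liftCycles_i (ModuleCat.ofHom (LinearMap.ker (C.d n (n + 1)).hom).subtype) (n + 1)
        (by simp) (by ext x; exact x.2))
  have hex : (ShortComplex.mk (C.toCycles m n) (C.homologyπ n)
      (C.toCycles_comp_homologyπ m n)).Exact :=
    ShortComplex.exact_of_g_is_cokernel _ (C.homologyIsCokernel m n hm)
  rw [ShortComplex.moduleCat_exact_iff] at hex
  constructor
  · intro h
    obtain ⟨y, hy⟩ := hex _ h
    refine ⟨y, ?_⟩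
    rw [← hi z, ← C.toCycles_i m n]
    exact congrArg (C.iCycles n).hom hy
  · rintro ⟨y, hy⟩
    have : (C.liftCycles (ModuleCat.ofHom (LinearMap.ker (C.d n (n + 1)).hom).subtype) (n + 1)
        (by simp) (by ext x; exact x.2)).hom z = (C.toCycles m n).hom y := by
      apply (ModuleCat.mono_iff_injective (C.iCycles n)).1 inferInstance
      refine (hi z).trans (hy.symm.trans ?_)
      rw [← C.toCycles_i m n]
      rfl
    rw [cls, ModuleCat.hom_comp, LinearMap.comp_apply, this]
    exact congrArg (fun f => f.hom y) (C.toCycles_comp_homologyπ m n)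

theorem cls_map {C C' : CochainComplex (ModuleCat.{v} k) ℕ} (φ : C ⟶ C') (n : ℕ)
    (z : LinearMap.ker (C.d n (n + 1)).hom) (z' : LinearMap.ker (C'.d n (n + 1)).hom)
    (h : (φ.f n).hom z.1 = z'.1) :
    (HomologicalComplex.homologyMap φ n).hom (cls C n z) = cls C' n z' := by
  have hi : ∀ (C : CochainComplex (ModuleCat.{v} k) ℕ) (z : LinearMap.ker (C.d n (n + 1)).hom),
      (C.iCycles n).hom
      ((C.liftCycles (ModuleCat.ofHom (LinearMap.ker (C.d n (n + 1)).hom).subtype) (n + 1)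
        (by simp) (by ext x; exact x.2)).hom z) = z.1 := fun C z =>
    congrArg (fun f => f.hom z)
      (C.liftCycles_i (ModuleCat.ofHom (LinearMap.ker (C.d n (n + 1)).hom).subtype) (n + 1)
        (by simp) (by ext x; exact x.2))
  rw [cls, cls, ← LinearMap.comp_apply, ← ModuleCat.hom_comp, Category.assoc,
    HomologicalComplex.homologyπ_naturality, ModuleCat.hom_comp, ModuleCat.hom_comp,
    ModuleCat.hom_comp, LinearMap.comp_apply, LinearMap.comp_apply, LinearMap.comp_apply]
  congr 1
  apply (ModuleCat.mono_iff_injective (C'.iCycles n)).1 inferInstance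
  refine Eq.trans ?_ (hi C' z').symm
  rw [← h, ← hi C z]
  exact congrArg (fun f => f.hom ((C.liftCycles (ModuleCat.ofHom
    (LinearMap.ker (C.d n (n + 1)).hom).subtype) (n + 1)
        (by simp) (by ext x; exact x.2)).hom z)) (HomologicalComplex.cyclesMap_i φ n)

end Classes

/-! ### The direct sum decomposition of the cohomology of `D^•` -/

namespace ZeroQSet

section Decomposition

variable {k : Type u} [Field k] {V : Type v} [Quiver.{r} V] (Δ : ZeroQSet.{u, v, w, r} k V)
variable [DecidableEq V] [Fintype V] [SimplyLaced V]

theorem Kcx_d (ω : QPath V) (n : ℕ) (f : Δ.K ω n) :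
    (((Δ.Kcx ω).d n (n + 1)).hom f : Δ.K ω (n + 1)).1 = Δ.dPath ω n f.1 := by
  simp only [Kcx, CochainComplex.of_d]
  rfl

theorem Dcx_d (n : ℕ) (f : Δ.D n) :
    ((Δ.Dcx.d n (n + 1)).hom f : Δ.D (n + 1)).1 = hd n f.1 := by
  simp only [Dcx, CochainComplex.of_d]
  rfl

/-- A cocycle of the complex of cochains along `ω`. -/
noncomputable def cocycle {ω : QPath V} {n : ℕ} (f : Coch k Δ.Alg n) (hf : f ∈ Δ.K ω n)
    (hf0 : Δ.dPath ω n f = 0) : LinearMap.ker ((Δ.Kcx ω).d n (n + 1)).hom :=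
  ⟨(⟨f, hf⟩ : Δ.K ω n), Subtype.ext ((Δ.Kcx_d ω n ⟨f, hf⟩).trans hf0)⟩

/-- The cochain underlying a cocycle along `ω`. -/
noncomputable def coch {ω : QPath V} {n : ℕ} :
    LinearMap.ker ((Δ.Kcx ω).d n (n + 1)).hom →ₗ[k] Coch k Δ.Alg n :=
  (Δ.K ω n).subtype ∘ₗ (LinearMap.ker ((Δ.Kcx ω).d n (n + 1)).hom).subtype

theorem coch_mem {ω : QPath V} {n : ℕ} (z : LinearMap.ker ((Δ.Kcx ω).d n (n + 1)).hom) :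
    Δ.coch z ∈ Δ.K ω n := (z.1 : Δ.K ω n).2

theorem dPath_coch {ω : QPath V} {n : ℕ} (z : LinearMap.ker ((Δ.Kcx ω).d n (n + 1)).hom) :
    Δ.dPath ω n (Δ.coch z) = 0 :=
  (Δ.Kcx_d ω n z.1).symm.trans (congrArg Subtype.val (show _ = (0 : Δ.K ω (n + 1)) from z.2))

theorem coch_injective {ω : QPath V} {n : ℕ} :
    Function.Injective (Δ.coch (ω := ω) (n := n)) := fun _ _ h =>
  Subtype.ext (Subtype.ext h)

theorem eq_zero_or_of_cls {ω : QPath V} {n : ℕ}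
    (z : LinearMap.ker ((Δ.Kcx ω).d n (n + 1)).hom) (hz : cls (Δ.Kcx ω) n z = 0) :
    Δ.coch z = 0 ∨ ∃ m, ∃ h : n = m + 1, ∃ y ∈ Δ.K ω m, Δ.dPath ω m y = h ▸ Δ.coch z := by
  rcases n with _ | m
  · obtain ⟨y, hy⟩ := (cls_eq_zero_iff _ 0 0 (by simp) z).1 hz
    left
    rw [(Δ.Kcx ω).shape 0 0 (by simp)] at hy
    exact congrArg Subtype.val (show (z.1 : Δ.K ω 0) = 0 from hy.symm)
  · obtain ⟨y, hy⟩ := (cls_eq_zero_iff _ (m + 1) m (by simp) z).1 hz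
    exact Or.inr ⟨m, rfl, y.1, y.2, (Δ.Kcx_d ω m y).symm.trans (congrArg Subtype.val hy)⟩

theorem cls_dPath {ω : QPath V} {n : ℕ}
    (z : LinearMap.ker ((Δ.Kcx ω).d (n + 1) (n + 1 + 1)).hom) (y : Coch k Δ.Alg n)
    (hy : y ∈ Δ.K ω n) (h : Δ.dPath ω n y = Δ.coch z) : cls (Δ.Kcx ω) (n + 1) z = 0 :=
  (cls_eq_zero_iff _ (n + 1) n (by simp) z).2
    ⟨(⟨y, hy⟩ : Δ.K ω n), Subtype.ext ((Δ.Kcx_d ω n ⟨y, hy⟩).trans h)⟩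

theorem sumHtoD_injective (n : ℕ) : Function.Injective (Δ.sumHtoD n) := by
  classical
  have key : ∀ (δ : DQ V) (f : ⨁ δ : DQ V, Δ.H δ.1 n),
      (HomologicalComplex.homologyMap (Δ.DtoK δ) n).hom (Δ.sumHtoD n f) = f δ := by
    intro δ f
    induction f using DirectSum.induction_on with
    | zero => simp
    | of δ' f =>
      have h1 : Δ.sumHtoD n (DirectSum.of (fun δ : DQ V => Δ.H δ.1 n) δ' f) =
          (HomologicalComplex.homologyMap (Δ.KtoD δ') n).hom f := by
        rw [sumHtoD]
        exact DirectSum.toModule_lof k (M := fun δ : DQ V => Δ.H δ.1 n) δ' f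
      rw [h1, ← LinearMap.comp_apply, ← ModuleCat.hom_comp,
        ← HomologicalComplex.homologyMap_comp]
      by_cases h : δ' = δ
      · subst h
        rw [KtoD_DtoK, HomologicalComplex.homologyMap_id, DirectSum.of_eq_same]
        rfl
      · rw [Δ.KtoD_DtoK_of_ne h, HomologicalComplex.homologyMap_zero,
          DirectSum.of_eq_of_ne _ _ _ (Ne.symm h)]
        rfl
    | add f g hf hg => rw [map_add, map_add, hf, hg, DirectSum.add_apply]
  intro f g hfg
  refine DFinsupp.ext fun δ => ?_
  rw [← key δ f, ← key δ g, hfg]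

/-- A cochain of `D^n` is the sum of its components along the non cycles. -/
theorem exists_sum_of_mem_D {n : ℕ} {f : Coch k Δ.Alg n} (hf : f ∈ Δ.D n) :
    ∃ s : Finset (DQ V), f = ∑ δ ∈ s, Δ.projPath δ.1 n f := by
  classical
  have h0 : ∀ f ∈ Δ.D n, ∃ s : Finset (DQ V), ∀ δ ∉ s, Δ.projPath δ.1 n f = 0 := by
    intro f hf
    refine Submodule.iSup_induction (fun δ : DQ V => Δ.K δ.1 n)
      (motive := fun f => ∃ s : Finset (DQ V), ∀ δ ∉ s, Δ.projPath δ.1 n f = 0)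
      hf ?_ ⟨∅, fun _ _ => map_zero _⟩ ?_
    · intro δ f hf
      refine ⟨{δ}, fun δ' h => Δ.projPath_of_mem_K_of_ne (fun e => h ?_) hf⟩
      rw [Finset.mem_singleton]
      exact Subtype.ext e
    · rintro f g ⟨s, hs⟩ ⟨t, ht⟩
      refine ⟨s ∪ t, fun δ h => ?_⟩
      rw [Finset.mem_union, not_or] at h
      rw [map_add, hs δ h.1, ht δ h.2, add_zero]
  obtain ⟨s, hs⟩ := h0 f hf
  refine ⟨s, ?_⟩
  rw [← sub_eq_zero]
  have hJ := Δ.D_le_J n hf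
  refine Δ.eq_zero_of_proj (sub_mem hJ (sum_mem fun δ _ =>
    Δ.K_le_J δ.1 n (Δ.projPath_mem_K δ.1 hJ))) fun x y σ => ?_
  rw [map_sub, map_sum, sub_eq_zero]
  by_cases hxy : x = y
  · subst hxy
    rw [(Δ.mem_D.1 hf).2]
    refine (Finset.sum_eq_zero fun δ _ => Δ.proj_projPath_of_ne ?_ f).symm
    intro h
    exact δ.2 (by rw [← h])
  · set δ₀ : DQ V := ⟨⟨x, y, σ.path⟩, hxy⟩ with hδ₀
    have h1 : Δ.proj σ.vert f = Δ.proj σ.vert (Δ.projPath δ₀.1 n f) :=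
      (Δ.proj_projPath_mk σ f).symm
    rw [h1, Finset.sum_eq_single δ₀]
    · intro δ _ hne
      exact Δ.proj_projPath_of_ne (fun e => hne (Subtype.ext e.symm)) f
    · intro h
      rw [hs _ h, map_zero]

theorem sumHtoD_surjective (n : ℕ) : Function.Surjective (Δ.sumHtoD n) := by
  classical
  intro x
  obtain ⟨z, rfl⟩ := cls_surjective _ _ x
  set f : Coch k Δ.Alg n := (z.1 : Δ.D n).1 with hfdef
  have hf : f ∈ Δ.D n := (z.1 : Δ.D n).2
  have hz : hd n f = 0 :=
    (Δ.Dcx_d n z.1).symm.trans (congrArg Subtype.val (show _ = (0 : Δ.D (n + 1)) from z.2))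
  obtain ⟨s, hs⟩ := Δ.exists_sum_of_mem_D hf
  have hK : ∀ δ : DQ V, Δ.projPath δ.1 n f ∈ Δ.K δ.1 n := fun δ =>
    Δ.projPath_mem_K δ.1 (Δ.D_le_J n hf)
  have hd0 : ∀ δ : DQ V, Δ.dPath δ.1 n (Δ.projPath δ.1 n f) = 0 := fun δ => by
    rw [Δ.projPath_hd_of_mem_D δ hf, hz, map_zero]
  have hhd0 : ∀ δ : DQ V, hd n (Δ.projPath δ.1 n f) = 0 := fun δ => by
    rw [← Δ.hd_of_non_cycle δ.2 (hK δ), hd0]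
  let zδ : DQ V → LinearMap.ker (Δ.Dcx.d n (n + 1)).hom := fun δ =>
    ⟨(⟨Δ.projPath δ.1 n f, Δ.K_le_D δ n (hK δ)⟩ : Δ.D n),
      Subtype.ext ((Δ.Dcx_d n _).trans (hhd0 δ))⟩
  have hsum : z = ∑ δ ∈ s, zδ δ := by
    refine Subtype.ext (Subtype.ext ?_)
    have h2 : ((∑ δ ∈ s, zδ δ : LinearMap.ker (Δ.Dcx.d n (n + 1)).hom).1 : Δ.D n).1 =
        ∑ δ ∈ s, Δ.projPath δ.1 n f :=
      map_sum ((Δ.D n).subtype ∘ₗ (LinearMap.ker (Δ.Dcx.d n (n + 1)).hom).subtype) zδ s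
    exact hs.trans h2.symm
  refine ⟨∑ δ ∈ s, DirectSum.lof k (DQ V) (fun δ : DQ V => Δ.H δ.1 n) δ
    (cls (Δ.Kcx δ.1) n (Δ.cocycle _ (hK δ) (hd0 δ))), ?_⟩
  rw [map_sum, hsum, map_sum]
  refine Finset.sum_congr rfl fun δ _ => ?_
  rw [sumHtoD]
  rw [DirectSum.toModule_lof]
  exact cls_map (Δ.KtoD δ) n _ _ rfl

/-- The canonical isomorphism `⊕_{δ ∈ DQ} H^n_δ(Δ) = H^n(D^•)`. -/
noncomputable def sumHtoDEquiv (n : ℕ) :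
    (⨁ δ : DQ V, Δ.H δ.1 n) ≃ₗ[k] Δ.Dcx.homology n :=
  LinearEquiv.ofBijective (Δ.sumHtoD n) ⟨Δ.sumHtoD_injective n, Δ.sumHtoD_surjective n⟩

/-- The connecting homomorphism `∇_n : ⊕_{γ ∈ CQ} H^n_γ(Δ) → ⊕_{δ ∈ DQ} H^{n+1}_δ(Δ)` of the
long exact sequence associated to `0 → D^• → J^• → (J/D)^• → 0`. -/
noncomputable def nabla (n : ℕ) :
    (⨁ γ : CQ V, Δ.H γ.1 n) →ₗ[k] ⨁ δ : DQ V, Δ.H δ.1 (n + 1) :=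
  (Δ.sumHtoDEquiv (n + 1)).symm.toLinearMap ∘ₗ
    (Δ.ses_shortExact.δ n (n + 1) (by simp)).hom ∘ₗ Δ.sumHtoQ n

end Decomposition

end ZeroQSet

/-! ### The cup product on the cohomology along paths -/

theorem Traj.exists_split {V : Type v} [Quiver.{r} V] (i : ℕ) :
    ∀ {j n : ℕ} (_ : i + j = n) {x z : V} (ρ : Traj x z n),
    ∃ (y : V) (τ' : Traj y z i) (τ : Traj x y j), ρ.path = τ.path.comp τ'.path ∧
      (∀ a ≤ i, τ'.vert a = ρ.vert a) ∧ ∀ a, τ.vert a = ρ.vert (i + a) := by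
  induction i with
  | zero =>
    intro j n h x z ρ
    obtain rfl : j = n := by omega
    refine ⟨z, .nil z, ρ, rfl, fun a ha => ?_, fun a => by rw [zero_add]⟩
    obtain rfl : a = 0 := by omega
    exact (vert_zero ρ).symm
  | succ i ih =>
    intro j n h x z ρ
    obtain ⟨n, rfl⟩ : ∃ n', n = n' + 1 := ⟨n - 1, by omega⟩
    cases ρ with
    | wait ρ =>
      obtain ⟨y, τ', τ, h1, h2, h3⟩ := ih (j := j) (by omega) ρ
      refine ⟨y, .wait τ', τ, h1, fun a ha => ?_, fun a => ?_⟩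
      · rcases a with _ | a
        · rfl
        · exact h2 a (by omega)
      · rw [h3, show i + 1 + a = (i + a) + 1 by omega]
        rfl
    | move b ρ =>
      obtain ⟨y, τ', τ, h1, h2, h3⟩ := ih (j := j) (by omega) ρ
      refine ⟨y, .move b τ', τ, by rw [path, h1]; rfl, fun a ha => ?_, fun a => ?_⟩
      · rcases a with _ | a
        · rfl
        · exact h2 a (by omega)
      · rw [h3, show i + 1 + a = (i + a) + 1 by omega]
        rfl

namespace ZeroQSet

section Cup

variable {k : Type u} [Field k] {V : Type v} [Quiver.{r} V] (Δ : ZeroQSet.{u, v, w, r} k V)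
variable [DecidableEq V]

theorem proj_cupC {i j n : ℕ} (h : i + j = n) (s : ℕ → V) {g : Coch k Δ.Alg i}
    (hg : g ∈ Δ.J i) (f : Coch k Δ.Alg j) :
    Δ.proj s (cupC h g f) = cupC h (Δ.proj s g) (Δ.proj (fun a => s (i + a)) f) := by
  subst h
  apply ev_ext
  intro v
  have key : Δ.e (s 0) * ev g (fun a => Δ.e (s a) * v a * Δ.e (s (a + 1))) =
      ev g (fun a => Δ.e (s a) * (Δ.e (s a) * v a)) * Δ.e (s i) :=
    (Δ.ev_mem_J hg (fun a => Pi.single (s a) 1) (fun a => Δ.e (s a) * v a)).symm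
  rw [ev_proj, ev_cupC, ev_cupC, ev_proj, ev_proj]
  simp only [← mul_assoc]
  rw [key]
  simp only [mul_assoc, add_zero, e_assoc, add_assoc]

variable [Fintype V] [SimplyLaced V]

theorem projPath_cupC {ω' ω : QPath V} (h : ω'.src = ω.tgt) {i j n : ℕ} (hn : i + j = n)
    {g : Coch k Δ.Alg i} {f : Coch k Δ.Alg j} (hg : g ∈ Δ.J i) (hf : f ∈ Δ.J j)
    (hfg : g ∈ Δ.K ω' i ∨ f ∈ Δ.K ω j) :
    Δ.projPath (QPath.concat ω' ω h) n (cupC hn g f) =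
      cupC hn (Δ.projPath ω' i g) (Δ.projPath ω j f) := by
  obtain ⟨x', y', p'⟩ := ω'
  obtain ⟨x, y, p⟩ := ω
  obtain rfl : x' = y := h
  rw [← sub_eq_zero]
  refine Δ.eq_zero_of_proj (sub_mem (Δ.K_le_J _ _ (Δ.projPath_mem_K _ (Δ.cupC_mem_J hn hg hf)))
    (Δ.cupC_mem_J hn (Δ.K_le_J _ _ (Δ.projPath_mem_K _ hg))
      (Δ.K_le_J _ _ (Δ.projPath_mem_K _ hf)))) fun s t ρ => ?_
  obtain ⟨q, τ', τ, h1, h2, h3⟩ := Traj.exists_split i hn ρ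
  have hcup : ∀ {g : Coch k Δ.Alg i} {f : Coch k Δ.Alg j}, g ∈ Δ.J i →
      Δ.proj ρ.vert (cupC hn g f) = cupC hn (Δ.proj τ'.vert g) (Δ.proj τ.vert f) := by
    intro g f hg
    rw [Δ.proj_cupC hn _ hg, Δ.proj_congr h2, ← funext h3]
  rw [map_sub, hcup (Δ.K_le_J _ _ (Δ.projPath_mem_K _ hg)), sub_eq_zero]
  by_cases hρ : (⟨s, t, ρ.path⟩ : QPath V) = QPath.concat ⟨x', y', p'⟩ ⟨x, x', p⟩ rfl
  · rw [← hρ, Δ.proj_projPath_mk, hcup hg]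
    by_cases hτ : (⟨s, q, τ.path⟩ : QPath V) = ⟨x, x', p⟩
    · have hτ' : (⟨q, t, τ'.path⟩ : QPath V) = ⟨x', y', p'⟩ := by
        simp only [QPath.mk.injEq, QPath.concat] at hτ hρ
        obtain ⟨rfl, rfl, hp⟩ := hτ
        obtain ⟨-, rfl, hr⟩ := hρ
        obtain rfl := eq_of_heq hp
        have := eq_of_heq hr
        rw [h1] at this
        have hc := Quiver.Path.comp_inj_right.1 this
        simpa using hc
      rw [← hτ, ← hτ', Δ.proj_projPath_mk, Δ.proj_projPath_mk]
    · rw [Δ.proj_projPath_of_ne hτ, map_zero]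
      rcases hfg with hg' | hf'
      · have hτ' : (⟨q, t, τ'.path⟩ : QPath V) ≠ ⟨x', y', p'⟩ := by
          intro hτ'
          apply hτ
          simp only [QPath.mk.injEq, QPath.concat] at hτ' hρ ⊢
          obtain ⟨rfl, rfl, hp⟩ := hτ'
          obtain ⟨rfl, -, hr⟩ := hρ
          obtain rfl := eq_of_heq hp
          have := eq_of_heq hr
          rw [h1] at this
          have hc := Quiver.Path.comp_inj_left.1 this
          exact ⟨rfl, rfl, heq_of_eq hc⟩
        rw [Δ.proj_of_mem_K hτ' hg', map_zero, LinearMap.zero_apply]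
      · rw [Δ.proj_of_mem_K hτ hf', map_zero]
  · rw [Δ.proj_projPath_of_ne hρ]
    by_cases hτ : (⟨s, q, τ.path⟩ : QPath V) = ⟨x, x', p⟩
    · have hτ' : (⟨q, t, τ'.path⟩ : QPath V) ≠ ⟨x', y', p'⟩ := by
        intro hτ'
        apply hρ
        simp only [QPath.mk.injEq, QPath.concat] at hτ hτ' ⊢
        obtain ⟨rfl, rfl, hp⟩ := hτ
        obtain ⟨-, rfl, hp'⟩ := hτ'
        obtain rfl := eq_of_heq hp
        obtain rfl := eq_of_heq hp'
        exact ⟨rfl, rfl, by rw [h1]; simp⟩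
      rw [Δ.proj_projPath_of_ne hτ', map_zero, LinearMap.zero_apply]
    · rw [Δ.proj_projPath_of_ne hτ, map_zero]

theorem cupC_mem_K {ω' ω : QPath V} (h : ω'.src = ω.tgt) {i j n : ℕ} (hn : i + j = n)
    {g : Coch k Δ.Alg i} {f : Coch k Δ.Alg j} (hg : g ∈ Δ.K ω' i) (hf : f ∈ Δ.K ω j) :
    cupC hn g f ∈ Δ.K (QPath.concat ω' ω h) n := by
  have hg' := Δ.mem_K.1 hg
  have hf' := Δ.mem_K.1 hf
  refine Δ.mem_K.2 ⟨Δ.cupC_mem_J hn hg'.1 hf'.1, ?_⟩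
  rw [Δ.projPath_cupC h hn hg'.1 hf'.1 (Or.inl hg), hg'.2, hf'.2]

/-- The graded Leibniz rule. -/
theorem dPath_cupC {ω' ω : QPath V} (h : ω'.src = ω.tgt) {i j n : ℕ} (hn : i + j = n)
    {g : Coch k Δ.Alg i} {f : Coch k Δ.Alg j} (hg : g ∈ Δ.K ω' i) (hf : f ∈ Δ.K ω j) :
    Δ.dPath (QPath.concat ω' ω h) n (cupC hn g f) =
      cupC (show (i + 1) + j = n + 1 by omega) (Δ.dPath ω' i g) f +
        (-1 : k) ^ i • cupC (show i + (j + 1) = n + 1 by omega) g (Δ.dPath ω j f) := by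
  have hg' := Δ.mem_K.1 hg
  have hf' := Δ.mem_K.1 hf
  rw [Δ.dPath_eq (Δ.cupC_mem_K h hn hg hf), hd_cupC, map_add, map_smul,
    Δ.projPath_cupC h _ (Δ.hd_mem_J hg'.1) hf'.1 (Or.inr hf),
    Δ.projPath_cupC h _ hg'.1 (Δ.hd_mem_J hf'.1) (Or.inl hg), hg'.2, hf'.2, Δ.dPath_eq hg,
    Δ.dPath_eq hf]

/-- The cup product of two cocycles along concatenable paths. -/
noncomputable def cupCoc {ω' ω : QPath V} (h : ω'.src = ω.tgt) {i j n : ℕ} (hn : i + j = n)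
    (z' : LinearMap.ker ((Δ.Kcx ω').d i (i + 1)).hom)
    (z : LinearMap.ker ((Δ.Kcx ω).d j (j + 1)).hom) :
    LinearMap.ker ((Δ.Kcx (QPath.concat ω' ω h)).d n (n + 1)).hom :=
  Δ.cocycle (cupC hn (Δ.coch z') (Δ.coch z))
    (Δ.cupC_mem_K h hn (Δ.coch_mem z') (Δ.coch_mem z))
    (by rw [Δ.dPath_cupC h hn (Δ.coch_mem z') (Δ.coch_mem z), dPath_coch, dPath_coch]; simp)

theorem coch_cupCoc {ω' ω : QPath V} (h : ω'.src = ω.tgt) {i j n : ℕ} (hn : i + j = n)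
    (z' : LinearMap.ker ((Δ.Kcx ω').d i (i + 1)).hom)
    (z : LinearMap.ker ((Δ.Kcx ω).d j (j + 1)).hom) :
    Δ.coch (Δ.cupCoc h hn z' z) = cupC hn (Δ.coch z') (Δ.coch z) := rfl

/-- The class of the cup product of two cocycles along concatenable paths. -/
noncomputable def cupZ (ω' ω : QPath V) (h : ω'.src = ω.tgt) {i j n : ℕ} (hn : i + j = n) :
    LinearMap.ker ((Δ.Kcx ω').d i (i + 1)).hom →ₗ[k]
      LinearMap.ker ((Δ.Kcx ω).d j (j + 1)).hom →ₗ[k] Δ.H (QPath.concat ω' ω h) n :=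
  (LinearMap.mk₂ k (Δ.cupCoc h hn)
    (fun z₁ z₂ z => Δ.coch_injective (by
      simp only [map_add, coch_cupCoc, LinearMap.add_apply]))
    (fun c z' z => Δ.coch_injective (by
      simp only [map_smul, coch_cupCoc, LinearMap.smul_apply]))
    (fun z' z₁ z₂ => Δ.coch_injective (by
      simp only [map_add, coch_cupCoc]))
    (fun c z' z => Δ.coch_injective (by
      simp only [map_smul, coch_cupCoc]))).compr₂ (cls (Δ.Kcx (QPath.concat ω' ω h)) n)

theorem cupZ_apply (ω' ω : QPath V) (h : ω'.src = ω.tgt) {i j n : ℕ} (hn : i + j = n)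
    (z' : LinearMap.ker ((Δ.Kcx ω').d i (i + 1)).hom)
    (z : LinearMap.ker ((Δ.Kcx ω).d j (j + 1)).hom) :
    Δ.cupZ ω' ω h hn z' z = cls (Δ.Kcx (QPath.concat ω' ω h)) n (Δ.cupCoc h hn z' z) := rfl

theorem cupZ_left (ω' ω : QPath V) (h : ω'.src = ω.tgt) {i j n : ℕ} (hn : i + j = n)
    (z' : LinearMap.ker ((Δ.Kcx ω').d i (i + 1)).hom) (hz' : cls (Δ.Kcx ω') i z' = 0)
    (z : LinearMap.ker ((Δ.Kcx ω).d j (j + 1)).hom) : Δ.cupZ ω' ω h hn z' z = 0 := by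
  rcases Δ.eq_zero_or_of_cls z' hz' with h0 | ⟨m, rfl, y, hy, hyz⟩
  · rw [show z' = 0 from Δ.coch_injective (h0.trans (map_zero _).symm), map_zero,
      LinearMap.zero_apply]
  · obtain ⟨n, rfl⟩ : ∃ n', n = n' + 1 := ⟨n - 1, by omega⟩
    rw [cupZ_apply]
    refine Δ.cls_dPath _ (cupC (show m + j = n by omega) y (Δ.coch z))
      (Δ.cupC_mem_K h _ hy (Δ.coch_mem z)) ?_
    rw [Δ.dPath_cupC h _ hy (Δ.coch_mem z), dPath_coch, map_zero, smul_zero, add_zero, hyz]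
    rfl

theorem cupZ_right (ω' ω : QPath V) (h : ω'.src = ω.tgt) {i j n : ℕ} (hn : i + j = n)
    (z' : LinearMap.ker ((Δ.Kcx ω').d i (i + 1)).hom)
    (z : LinearMap.ker ((Δ.Kcx ω).d j (j + 1)).hom) (hz : cls (Δ.Kcx ω) j z = 0) :
    Δ.cupZ ω' ω h hn z' z = 0 := by
  rcases Δ.eq_zero_or_of_cls z hz with h0 | ⟨m, rfl, y, hy, hyz⟩
  · rw [show z = 0 from Δ.coch_injective (h0.trans (map_zero _).symm), map_zero]
  · obtain ⟨n, rfl⟩ : ∃ n', n = n' + 1 := ⟨n - 1, by omega⟩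
    rw [cupZ_apply]
    refine Δ.cls_dPath _ ((-1 : k) ^ i • cupC (show i + m = n by omega) (Δ.coch z') y)
      (Submodule.smul_mem _ _ (Δ.cupC_mem_K h _ (Δ.coch_mem z') hy)) ?_
    rw [map_smul, Δ.dPath_cupC h _ (Δ.coch_mem z') hy, dPath_coch, map_zero, LinearMap.zero_apply,
      zero_add, smul_smul, ← pow_add, Even.neg_one_pow ⟨i, rfl⟩, one_smul, hyz]
    rfl

/-- The cup product `H^i_{ω'}(Δ) × H^j_ω(Δ) → H^{i+j}_{ω'ω}(Δ)` for concatenable paths. -/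
noncomputable def cupH (ω' ω : QPath V) (h : ω'.src = ω.tgt) {i j n : ℕ} (hn : i + j = n) :
    Δ.H ω' i →ₗ[k] Δ.H ω j →ₗ[k] Δ.H (QPath.concat ω' ω h) n :=
  ((LinearMap.ker (cls (Δ.Kcx ω') i)).liftQ
    (((LinearMap.ker (cls (Δ.Kcx ω) j)).liftQ (Δ.cupZ ω' ω h hn).flip fun z hz =>
      LinearMap.ext fun z' => Δ.cupZ_right ω' ω h hn z' z hz).flip) (by
        intro z' hz'
        refine LinearMap.ext fun q => ?_
        obtain ⟨z, rfl⟩ := Submodule.mkQ_surjective _ q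
        exact Δ.cupZ_left ω' ω h hn z' hz' z) ∘ₗ
    ((cls (Δ.Kcx ω') i).quotKerEquivOfSurjective (cls_surjective _ _)).symm.toLinearMap).compl₂
      ((cls (Δ.Kcx ω) j).quotKerEquivOfSurjective (cls_surjective _ _)).symm.toLinearMap

/-- The cup product on classes is induced by the cup product of cochains. -/
theorem cupH_cls (ω' ω : QPath V) (h : ω'.src = ω.tgt) {i j n : ℕ} (hn : i + j = n)
    (z' : LinearMap.ker ((Δ.Kcx ω').d i (i + 1)).hom)
    (z : LinearMap.ker ((Δ.Kcx ω).d j (j + 1)).hom) :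
    Δ.cupH ω' ω h hn (cls _ i z') (cls _ j z) = Δ.cupZ ω' ω h hn z' z := by
  have h1 : ((cls (Δ.Kcx ω') i).quotKerEquivOfSurjective (cls_surjective _ _)).symm (cls _ i z') =
      Submodule.Quotient.mk z' := by
    rw [LinearEquiv.symm_apply_eq]
    rfl
  have h2 : ((cls (Δ.Kcx ω) j).quotKerEquivOfSurjective (cls_surjective _ _)).symm (cls _ j z) =
      Submodule.Quotient.mk z := by
    rw [LinearEquiv.symm_apply_eq]
    rfl
  simp only [cupH, LinearMap.compl₂_apply, LinearMap.comp_apply, LinearEquiv.coe_coe, h1, h2]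
  rfl

open Classical in
/-- A class along a path `ω`, as an element of `⊕_ω H^n_ω(Δ)`. -/
noncomputable def atPath (ω : QPath V) {n : ℕ} : Δ.H ω n →ₗ[k] ⨁ ω : QPath V, Δ.H ω n :=
  DirectSum.lof k (QPath V) (fun ω => Δ.H ω n) ω

open Classical in
/-- The cup product on `⊕_ω H^•_ω(Δ)`, where `ω` runs over all the paths. It is zero on classes along
paths which are not concatenable. -/
noncomputable def cup {i j n : ℕ} (hn : i + j = n) :
    (⨁ ω : QPath V, Δ.H ω i) →ₗ[k] (⨁ ω : QPath V, Δ.H ω j) →ₗ[k] ⨁ ω : QPath V, Δ.H ω n :=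
  DirectSum.toModule k (QPath V) _ fun ω' => LinearMap.flip <|
    DirectSum.toModule k (QPath V) _ fun ω =>
      if h : ω'.src = ω.tgt then
        (Δ.cupH ω' ω h hn).flip.compr₂ (Δ.atPath (QPath.concat ω' ω h))
      else 0

theorem cup_atPath {ω' ω : QPath V} (h : ω'.src = ω.tgt) {i j n : ℕ} (hn : i + j = n)
    (f' : Δ.H ω' i) (f : Δ.H ω j) :
    Δ.cup hn (Δ.atPath ω' f') (Δ.atPath ω f) =
      Δ.atPath (QPath.concat ω' ω h) (Δ.cupH ω' ω h hn f' f) := by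
  classical
  simp only [cup]
  rw [atPath, atPath, DirectSum.toModule_lof, LinearMap.flip_apply, DirectSum.toModule_lof,
    dif_pos h]
  rfl

theorem cup_atPath_of_ne {ω' ω : QPath V} (h : ω'.src ≠ ω.tgt) {i j n : ℕ} (hn : i + j = n)
    (f' : Δ.H ω' i) (f : Δ.H ω j) : Δ.cup hn (Δ.atPath ω' f') (Δ.atPath ω f) = 0 := by
  classical
  simp only [cup]
  rw [atPath, atPath, DirectSum.toModule_lof, LinearMap.flip_apply, DirectSum.toModule_lof,
    dif_neg h]
  rfl

/-! ### The canonical element -/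

/-- The identity of the bimodule `M_a`, as a cochain along `a` of degree one: the map
`Λ → Λ`, `v ↦ e_{t(a)} v e_{s(a)}`, which is the identity of `M_a = e_{t(a)} Λ e_{s(a)}` extended
by zero. -/
noncomputable def idCochain {x y : V} (_ : x ⟶ y) : Coch k Δ.Alg 1 :=
  MultilinearMap.ofSubsingleton k Δ.Alg Δ.Alg (0 : Fin 1)
    (LinearMap.mulLeft k (Δ.e y) ∘ₗ LinearMap.mulRight k (Δ.e x))

theorem ev_idCochain {x y : V} (a : x ⟶ y) (v : ℕ → Δ.Alg) :
    ev (Δ.idCochain a) v = Δ.e y * (v 0 * Δ.e x) := rfl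

theorem idCochain_mem_K {x y : V} (a : x ⟶ y) : Δ.idCochain a ∈ Δ.K (QPath.ofArrow a) 1 := by
  refine Submodule.mem_iSup_of_mem
    (⟨Traj.move a (Traj.nil x), rfl⟩ : TrajOver (QPath.ofArrow a) 1) ⟨?_, ?_⟩
  · rw [mem_J_iff]
    intro c v
    rw [ev_idCochain, ev_idCochain]
    simp only [mul_assoc]
    rw [← mul_assoc (Δ.diag (c 0)) (Δ.e y), diag_comm_e, ← diag_comm_e Δ (c 1)]
    simp only [mul_assoc]
  · apply ev_ext
    intro v
    rw [ev_proj, ev_idCochain, ev_idCochain]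
    change Δ.e y * (Δ.e y * (Δ.e y * v 0 * Δ.e x * Δ.e x) * Δ.e x) = _
    simp only [mul_assoc, e_assoc, e_mul_self]

theorem dPath_idCochain {x y : V} (a : x ⟶ y) :
    Δ.dPath (QPath.ofArrow a) 1 (Δ.idCochain a) = 0 := by
  have hxy : x ≠ y := by
    rintro rfl
    exact (SimplyLaced.isEmpty_loop x).false a
  rw [Δ.hd_of_non_cycle hxy (Δ.idCochain_mem_K a)]
  apply ev_ext
  intro v
  have h : ev (hd 1 (Δ.idCochain a)) v = v 0 * (Δ.e y * (v 1 * Δ.e x)) -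
      Δ.e y * (v 0 * v 1 * Δ.e x) + Δ.e y * (v 0 * Δ.e x) * v 1 := by
    simp [ev, hd_apply, idCochain, Fin.contractNth, sub_eq_add_neg]
  rw [h, ev_z]
  simp only [← mul_assoc]
  apply TrivSqZeroExt.ext
  · funext p
    simp only [TrivSqZeroExt.fst_add, TrivSqZeroExt.fst_sub, TrivSqZeroExt.fst_mul, Pi.add_apply,
      Pi.sub_apply, Pi.mul_apply, fst_e]
    by_cases h1 : p = y
    · subst h1
      simp [Ne.symm hxy]
    · simp [h1]
  · funext p q b
    have hs : ∀ s t : Δ.Alg, (s * t).snd p q b =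
        s.fst q • t.snd p q b + MulOpposite.op (t.fst p) • s.snd p q b := fun _ _ => rfl
    have ha : ∀ s t u : Δ.Alg, (s - t + u).snd p q b =
        s.snd p q b - t.snd p q b + u.snd p q b := fun _ _ _ => rfl
    have he : ∀ z : V, (Δ.e z).snd p q b = 0 := fun _ => rfl
    rw [ha]
    simp only [hs, he, TrivSqZeroExt.fst_mul, Pi.mul_apply, fst_e]
    change _ = (0 : Δ.M b)
    have hyx : y ≠ x := hxy.symm
    by_cases h1 : p = x <;> by_cases h2 : q = y <;> by_cases h3 : p = y <;>
      by_cases h4 : q = x <;>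
      first
        | exact absurd (h1.symm.trans h3) hxy
        | exact absurd (h4.symm.trans h2) hxy
        | simp [h1, h2, h3, h4, hxy, hyx]

/-- The canonical element `1_{M_a}` of `H^1_a(Δ)`. -/
noncomputable def idClass {x y : V} (a : x ⟶ y) : Δ.H (QPath.ofArrow a) 1 :=
  cls (Δ.Kcx (QPath.ofArrow a)) 1
    (Δ.cocycle (Δ.idCochain a) (Δ.idCochain_mem_K a) (Δ.dPath_idCochain a))

/-- The canonical element `1_M = ∑_a 1_{M_a}` of `⊕_a H^1_a(Δ)`, viewed in `⊕_ω H^1_ω(Δ)`. -/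
noncomputable def oneM : ⨁ ω : QPath V, Δ.H ω 1 :=
  haveI (x y : V) : Subsingleton (x ⟶ y) := SimplyLaced.subsingleton_hom x y
  letI (x y : V) : Fintype (x ⟶ y) := Fintype.ofFinite _
  ∑ x : V, ∑ y : V, ∑ a : x ⟶ y,
    Δ.atPath (QPath.ofArrow a) (Δ.idClass a)

open Classical in
/-- The inclusion `⊕_{δ ∈ DQ} H^n_δ(Δ) → ⊕_ω H^n_ω(Δ)`. -/
noncomputable def inclDQ (n : ℕ) :
    (⨁ δ : DQ V, Δ.H δ.1 n) →ₗ[k] ⨁ ω : QPath V, Δ.H ω n :=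
  DirectSum.toModule k (DQ V) _ fun δ => Δ.atPath δ.1

open Classical in
/-- A class along a cycle `γ`, as an element of `⊕_{γ ∈ CQ} H^n_γ(Δ)`. -/
noncomputable def atCycle (γ : CQ V) {n : ℕ} : Δ.H γ.1 n →ₗ[k] ⨁ γ : CQ V, Δ.H γ.1 n :=
  DirectSum.lof k (CQ V) (fun γ => Δ.H γ.1 n) γ

end Cup

end ZeroQSet

end PathCohomology

/-!
Let `f` be a cocycle along a cycle `γ`. Seen in `J^n`, it lifts its own image in `(J/D)^n`, so that
the connecting homomorphism takes the class of `f` to the class of the Hochschild coboundary `hd f`,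
which lies in `D^{n+1}` (`δ_cls`, `sumHtoD_nabla_atCycle`).

The coboundary `hd f` is computed on the nose (`hd_eq_of_cocycle_of_cycle`), with no further
coboundary to correct it. The inner faces of `f` keep the end vertices of `γ`, so their components
all lie over cycles. The outer faces are `1_Λ ⌣ f` and `f ⌣ 1_Λ`, where `1_Λ` is the identity of
`Λ = A ⊕ M`. Replacing `1_Λ` by its part `1_M`, the projection on `M`, discards precisely the components
over cycles: in a simply laced quiver, a cycle extended by an arrow is never a cycle. Since the
components of `hd f` over cycles add up to the coboundary of `f` along `γ`, which is zero, this gives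
`hd f = 1_M ⌣ f + (-1)^{n+1} f ⌣ 1_M` as cochains.

It remains to compare classes. The cup product of a cocycle along an arrow `a` with a cocycle along
`γ` is either zero or a cocycle along a path which is not a cycle, of length one more than that of
`γ`. The elements of `⊕_ω H^{n+1}_ω(Δ)` and the cochains of `D^{n+1}` that come from the same element
of `⊕_{δ ∈ DQ} H^{n+1}_δ(Δ)` form a subspace of pairs (`sameClass`), to which the cup products by `1_M`
belong (`cup_oneM_left_mem_sameClass`, `cup_oneM_right_mem_sameClass`). The injectivity of
`⊕_{δ ∈ DQ} H^{n+1}_δ(Δ) → H^{n+1}(D^•)` concludes.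
-/

namespace PathCohomology

namespace ZeroQSet

variable {k : Type u} [Field k] {V : Type v} [Quiver.{r} V] (Δ : ZeroQSet.{u, v, w, r} k V)
variable [DecidableEq V] [Fintype V] [SimplyLaced V]

/-! ### Cochains along a path and projections on sequences of vertices -/

/-- Unlike `proj_of_mem_K`, this needs no trajectory over the sequence of vertices `s`. -/
theorem proj_of_mem_K_of_ends {ω : QPath V} {n : ℕ} {f : Coch k Δ.Alg n} (hf : f ∈ Δ.K ω n)
    {s : ℕ → V} (hs : s 0 ≠ ω.tgt ∨ s n ≠ ω.src) : Δ.proj s f = 0 := by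
  rw [← (Δ.mem_K.1 hf).2, projPath_apply, map_sum]
  refine Finset.sum_eq_zero fun τ _ => ?_
  rcases hs with hs | hs
  · exact Δ.proj_proj_of_ne (Nat.zero_le n) (by rwa [Traj.vert_zero]) f
  · exact Δ.proj_proj_of_ne le_rfl (by rwa [Traj.vert_last _ _ le_rfl]) f

theorem proj_of_mem_K_of_cycle {γ : QPath V} (hγ : γ.src = γ.tgt) {n : ℕ} {f : Coch k Δ.Alg n}
    (hf : f ∈ Δ.K γ n) {s : ℕ → V} (hs : s 0 ≠ s n) : Δ.proj s f = 0 := by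
  refine Δ.proj_of_mem_K_of_ends hf ?_
  by_contra! h
  exact hs (h.1.trans (hγ.symm.trans h.2.symm))

theorem cupC_eq_zero_of_ne {ω' ω : QPath V} (h : ω'.src ≠ ω.tgt) {i j n : ℕ} (hn : i + j = n)
    {g : Coch k Δ.Alg i} {f : Coch k Δ.Alg j} (hg : g ∈ Δ.K ω' i) (hf : f ∈ Δ.K ω j) :
    cupC hn g f = 0 := by
  have hg' := Δ.K_le_J _ _ hg
  refine Δ.eq_zero_of_proj (Δ.cupC_mem_J hn hg' (Δ.K_le_J _ _ hf)) fun x y σ => ?_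
  rw [Δ.proj_cupC hn _ hg']
  by_cases hs : σ.vert i = ω'.src
  · rw [Δ.proj_of_mem_K_of_ends hf (Or.inl (by rw [add_zero, hs]; exact h)), map_zero]
  · rw [Δ.proj_of_mem_K_of_ends hg (Or.inr hs), map_zero, LinearMap.zero_apply]

/-! ### The Hochschild coboundary of a cocycle along a cycle -/

/-- The identity of `Λ`, as a cochain of degree one. -/
noncomputable def idC : Coch k Δ.Alg 1 :=
  MultilinearMap.ofSubsingleton k Δ.Alg Δ.Alg (0 : Fin 1) LinearMap.id

theorem ev_idC (v : ℕ → Δ.Alg) : ev Δ.idC v = v 0 := rfl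

theorem idC_mem_J : Δ.idC ∈ Δ.J 1 := by
  rw [mem_J_iff]
  intro c v
  rw [ev_idC, ev_idC, mul_assoc]

theorem leftFace_eq_cupC {n : ℕ} (h : 1 + n = n + 1) (f : Coch k Δ.Alg n) :
    leftFace n f = cupC h Δ.idC f := by
  apply ev_ext
  intro v
  rw [ev_leftFace, ev_cupC, ev_idC]
  simp only [add_comm]

theorem rightFace_eq_cupC {n : ℕ} (f : Coch k Δ.Alg n) :
    rightFace n f = cupC rfl f Δ.idC := by
  apply ev_ext
  intro v
  rw [ev_rightFace, ev_cupC, ev_idC, add_zero]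

/-- The cochain `∑_a 1_{M_a}`, the sum running over all the arrows: the projection of
`Λ = A ⊕ M` on `M`. -/
noncomputable def oneMCochain : Coch k Δ.Alg 1 :=
  haveI (x y : V) : Subsingleton (x ⟶ y) := SimplyLaced.subsingleton_hom x y
  letI (x y : V) : Fintype (x ⟶ y) := Fintype.ofFinite _
  ∑ x : V, ∑ y : V, ∑ a : x ⟶ y, Δ.idCochain a

theorem oneMCochain_mem_J : Δ.oneMCochain ∈ Δ.J 1 :=
  sum_mem fun _ _ => sum_mem fun _ _ => sum_mem fun a _ => Δ.K_le_J _ _ (Δ.idCochain_mem_K a)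

theorem proj_oneMCochain_of_eq {s : ℕ → V} (hs : s 0 = s 1) : Δ.proj s Δ.oneMCochain = 0 := by
  simp only [oneMCochain, map_sum]
  refine Finset.sum_eq_zero fun x _ => Finset.sum_eq_zero fun y _ => Finset.sum_eq_zero fun a _ => ?_
  refine Δ.proj_of_mem_K_of_ends (Δ.idCochain_mem_K a) ?_
  by_contra! h
  obtain rfl : y = x := h.1.symm.trans (hs.trans h.2)
  exact (SimplyLaced.isEmpty_loop y).false a

theorem proj_oneMCochain_of_ne {s : ℕ → V} (hs : s 0 ≠ s 1) :
    Δ.proj s Δ.oneMCochain = Δ.proj s Δ.idC := by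
  have (x y : V) : Subsingleton (x ⟶ y) := SimplyLaced.subsingleton_hom x y
  have hz : ∀ {x y : V} (a : x ⟶ y), (s 0 ≠ y ∨ s 1 ≠ x) → Δ.proj s (Δ.idCochain a) = 0 :=
    fun a h => Δ.proj_of_mem_K_of_ends (Δ.idCochain_mem_K a) h
  let (x y : V) : Fintype (x ⟶ y) := Fintype.ofFinite _
  simp only [oneMCochain, map_sum]
  rw [Finset.sum_eq_single (s 1), Finset.sum_eq_single (s 0)]
  · rcases isEmpty_or_nonempty (s 1 ⟶ s 0) with h | ⟨⟨a⟩⟩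
    · rw [Finset.univ_eq_empty, Finset.sum_empty]
      apply ev_ext
      intro v
      rw [ev_z, ev_proj, ev_idC, Δ.e_mul_mul_e_eq_zero hs h, zero_mul, mul_zero]
    · rw [Finset.sum_eq_single a (fun b _ h => absurd (Subsingleton.elim b a) h)
        (fun h => absurd (Finset.mem_univ _) h)]
      apply ev_ext
      intro v
      rw [ev_proj, ev_proj, ev_idCochain, ev_idC]
      simp only [mul_assoc, e_assoc, e_mul_self]
  · exact fun y _ h => Finset.sum_eq_zero fun a _ => hz a (Or.inl h.symm)
  · exact fun h => absurd (Finset.mem_univ _) h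
  · exact fun x _ h => Finset.sum_eq_zero fun y _ => Finset.sum_eq_zero fun a _ =>
      hz a (Or.inr h.symm)
  · exact fun h => absurd (Finset.mem_univ _) h

theorem proj_cupC_oneMCochain_left {γ : QPath V} (hγ : γ.src = γ.tgt) {n : ℕ}
    (h : 1 + n = n + 1) {f : Coch k Δ.Alg n} (hf : f ∈ Δ.K γ n) (s : ℕ → V) :
    Δ.proj s (cupC h Δ.oneMCochain f) =
      if s 0 = s (n + 1) then 0 else Δ.proj s (leftFace n f) := by
  have hz : s 1 ≠ s (n + 1) → Δ.proj (fun a => s (1 + a)) f = 0 := fun h =>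
    Δ.proj_of_mem_K_of_cycle hγ hf (by simpa [add_comm] using h)
  rw [leftFace_eq_cupC Δ h, Δ.proj_cupC h _ Δ.oneMCochain_mem_J, Δ.proj_cupC h _ Δ.idC_mem_J]
  by_cases h1 : s 1 = s (n + 1)
  · split_ifs with h0
    · rw [Δ.proj_oneMCochain_of_eq (h0.trans h1.symm), map_zero, LinearMap.zero_apply]
    · rw [Δ.proj_oneMCochain_of_ne (by rwa [h1])]
  · rw [hz h1, map_zero, map_zero, ite_self]

theorem proj_cupC_oneMCochain_right {γ : QPath V} (hγ : γ.src = γ.tgt) {n : ℕ}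
    {f : Coch k Δ.Alg n} (hf : f ∈ Δ.K γ n) (s : ℕ → V) :
    Δ.proj s (cupC (rfl : n + 1 = n + 1) f Δ.oneMCochain) =
      if s 0 = s (n + 1) then 0 else Δ.proj s (rightFace n f) := by
  have hJ := Δ.K_le_J _ _ hf
  rw [rightFace_eq_cupC, Δ.proj_cupC rfl _ hJ, Δ.proj_cupC rfl _ hJ]
  by_cases h1 : s 0 = s n
  · split_ifs with h0
    · rw [Δ.proj_oneMCochain_of_eq (s := fun a => s (n + a)) (h1.symm.trans h0), map_zero]
    · rw [Δ.proj_oneMCochain_of_ne (s := fun a => s (n + a))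
        (fun e => h0 (h1.trans e))]
  · rw [Δ.proj_of_mem_K_of_cycle hγ hf h1, map_zero, LinearMap.zero_apply, LinearMap.zero_apply,
      ite_self]

theorem proj_midFace_of_cycle {γ : QPath V} (hγ : γ.src = γ.tgt) {n : ℕ} (i : Fin n)
    {f : Coch k Δ.Alg n} (hf : f ∈ Δ.K γ n) {s : ℕ → V} (hs : s 0 ≠ s (n + 1)) :
    Δ.proj s (midFace i f) = 0 := by
  rw [Δ.proj_midFace i (fun j _ => rfl), Δ.proj_of_mem_K_of_cycle hγ hf, map_zero, map_zero]
  simpa [show ¬ n < (i : ℕ) + 1 by omega] using hs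

/-- The components of `hd f` over cycles vanish because `f` is a cocycle along `γ`. Over a non cycle
the inner faces of `f` have no component, and the outer faces, which multiply the values of `f`
by an element of `Λ`, only see the component in `M` of this element: its component in `A` does not
change the end vertices of `γ`. -/
theorem hd_eq_of_cocycle_of_cycle {γ : QPath V} (hγ : γ.src = γ.tgt) {n : ℕ} (h : 1 + n = n + 1)
    {f : Coch k Δ.Alg n} (hf : f ∈ Δ.K γ n) (hf0 : Δ.dPath γ n f = 0) :
    hd n f = cupC h Δ.oneMCochain f + (-1 : k) ^ (n + 1) • cupC rfl f Δ.oneMCochain := by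
  have hJ := Δ.K_le_J _ _ hf
  rw [← sub_eq_zero]
  refine Δ.eq_zero_of_proj (sub_mem (Δ.hd_mem_J hJ) (add_mem
    (Δ.cupC_mem_J h Δ.oneMCochain_mem_J hJ) (Submodule.smul_mem _ _
      (Δ.cupC_mem_J rfl hJ Δ.oneMCochain_mem_J)))) fun x y σ => ?_
  rw [map_sub, map_add, map_smul, Δ.proj_cupC_oneMCochain_left hγ h hf,
    Δ.proj_cupC_oneMCochain_right hγ hf, Traj.vert_zero, Traj.vert_last _ _ le_rfl]
  by_cases hxy : y = x
  · subst hxy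
    have := Δ.proj_hd_of_cycle hγ hf σ
    rw [hf0, sub_zero] at this
    simp [this]
  · have hs : σ.vert 0 ≠ σ.vert (n + 1) := by
      rwa [Traj.vert_zero, Traj.vert_last _ _ le_rfl]
    rw [if_neg hxy, if_neg hxy, hd]
    simp only [LinearMap.add_apply, LinearMap.sum_apply, LinearMap.smul_apply, map_add, map_sum,
      map_smul, Δ.proj_midFace_of_cycle hγ _ hf hs, smul_zero, Finset.sum_const_zero, add_zero,
      sub_self]

end ZeroQSet

/-! ### The connecting homomorphism on classes of cocycles -/

/-- The snake lemma description of the connecting homomorphism, on classes of cocycles. -/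
theorem δ_cls {k : Type u} [Field k] {S : ShortComplex (CochainComplex (ModuleCat.{v} k) ℕ)}
    (hS : S.ShortExact) (n : ℕ) (z₃ : LinearMap.ker (S.X₃.d n (n + 1)).hom) (x₂ : S.X₂.X n)
    (h₂ : (S.g.f n).hom x₂ = z₃.1) (z₁ : LinearMap.ker (S.X₁.d (n + 1) (n + 1 + 1)).hom)
    (h₁ : (S.f.f (n + 1)).hom z₁.1 = (S.X₂.d n (n + 1)).hom x₂) :
    (hS.δ n (n + 1) (by simp)).hom (cls S.X₃ n z₃) = cls S.X₁ (n + 1) z₁ := by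
  -- `δ_eq` is stated for generalized elements: it is applied to the space `U` of all the pairs
  -- `(x₂, x₁)` such that `d x₂` is the image of `x₁`.
  let U : Submodule k (S.X₂.X n × S.X₁.X (n + 1)) :=
    LinearMap.eqLocus ((S.f.f (n + 1)).hom ∘ₗ LinearMap.snd k _ _)
      ((S.X₂.d n (n + 1)).hom ∘ₗ LinearMap.fst k _ _)
  let p₂ : ModuleCat.of k U ⟶ S.X₂.X n := ModuleCat.ofHom (LinearMap.fst k _ _ ∘ₗ U.subtype)
  let p₁ : ModuleCat.of k U ⟶ S.X₁.X (n + 1) := ModuleCat.ofHom (LinearMap.snd k _ _ ∘ₗ U.subtype)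
  have hp : p₁ ≫ S.f.f (n + 1) = p₂ ≫ S.X₂.d n (n + 1) :=
    ModuleCat.hom_ext (LinearMap.ext fun q => q.2)
  have hp₃ : (p₂ ≫ S.g.f n) ≫ S.X₃.d n (n + 1) = 0 := by
    have hfg : S.f.f (n + 1) ≫ S.g.f (n + 1) = 0 := by
      rw [← HomologicalComplex.comp_f, S.zero, HomologicalComplex.zero_f]
    rw [Category.assoc, S.g.comm, ← Category.assoc, ← hp, Category.assoc, hfg, Limits.comp_zero]
  have key := hS.δ_eq n (n + 1) (by simp) (p₂ ≫ S.g.f n) hp₃ p₂ rfl p₁ hp (n + 1 + 1) (by simp)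
  let q : U := ⟨(x₂, z₁.1), h₁⟩
  have hlift : ∀ (C : CochainComplex (ModuleCat.{v} k) ℕ) (i : ℕ) (φ : ModuleCat.of k U ⟶ C.X i)
      (hφ : φ ≫ C.d i (i + 1) = 0) (z : LinearMap.ker (C.d i (i + 1)).hom), φ.hom q = z.1 →
      (C.homologyπ i).hom ((C.liftCycles φ (i + 1) (by simp) hφ).hom q) = cls C i z := by
    intro C i φ hφ z hz
    rw [cls, ModuleCat.hom_comp, LinearMap.comp_apply]
    congr 1
    apply (ModuleCat.mono_iff_injective (C.iCycles i)).1 inferInstance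
    have e₁ := congrArg (fun f => f.hom q) (C.liftCycles_i φ (i + 1) (by simp) hφ)
    have e₂ := congrArg (fun f => f.hom z)
      (C.liftCycles_i (ModuleCat.ofHom (LinearMap.ker (C.d i (i + 1)).hom).subtype) (i + 1)
        (by simp) (by ext x; exact x.2))
    exact e₁.trans (hz.trans e₂.symm)
  rw [← hlift S.X₃ n (p₂ ≫ S.g.f n) hp₃ z₃ h₂, ← hlift S.X₁ (n + 1) p₁ _ z₁ rfl]
  exact congrArg (fun f => f.hom q) key

namespace ZeroQSet

variable {k : Type u} [Field k] {V : Type v} [Quiver.{r} V] (Δ : ZeroQSet.{u, v, w, r} k V)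
variable [DecidableEq V] [Fintype V] [SimplyLaced V]

theorem sumHtoD_lof_cls (δ : DQ V) {n : ℕ} (z : LinearMap.ker ((Δ.Kcx δ.1).d n (n + 1)).hom)
    (t : LinearMap.ker (Δ.Dcx.d n (n + 1)).hom) (h : (t.1 : Δ.D n).1 = Δ.coch z)
    [DecidableEq (DQ V)] :
    Δ.sumHtoD n (DirectSum.lof k (DQ V) (fun δ : DQ V => Δ.H δ.1 n) δ (cls (Δ.Kcx δ.1) n z)) =
      cls Δ.Dcx n t := by
  have h1 : Δ.sumHtoD n (DirectSum.lof k (DQ V) (fun δ : DQ V => Δ.H δ.1 n) δ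
      (cls (Δ.Kcx δ.1) n z)) = (HomologicalComplex.homologyMap (Δ.KtoD δ) n).hom (cls _ n z) := by
    rw [sumHtoD]
    convert DirectSum.toModule_lof k (M := fun δ : DQ V => Δ.H δ.1 n) δ (cls (Δ.Kcx δ.1) n z)
  rw [h1]
  exact cls_map (Δ.KtoD δ) n z t (Subtype.ext h.symm)

/-- A cocycle `z` along `γ`, seen in `J^n`, lifts its image in `(J/D)^n`: the connecting
homomorphism takes its class to the class of `hd z`, which lies in `D^{n+1}`. -/
theorem sumHtoD_nabla_atCycle (γ : CQ V) {n : ℕ}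
    (z : LinearMap.ker ((Δ.Kcx γ.1).d n (n + 1)).hom)
    (t : LinearMap.ker (Δ.Dcx.d (n + 1) (n + 1 + 1)).hom)
    (h : (t.1 : Δ.D (n + 1)).1 = hd n (Δ.coch z)) :
    Δ.sumHtoD (n + 1) (Δ.nabla n (Δ.atCycle γ (cls (Δ.Kcx γ.1) n z))) =
      cls Δ.Dcx (n + 1) t := by
  have h0 : Δ.sumHtoQ n (Δ.atCycle γ (cls (Δ.Kcx γ.1) n z)) =
      (HomologicalComplex.homologyMap (Δ.KtoQ γ) n).hom (cls _ n z) := by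
    rw [sumHtoQ, atCycle]
    classical
    convert DirectSum.toModule_lof k (M := fun γ : CQ V => Δ.H γ.1 n) γ (cls (Δ.Kcx γ.1) n z)
  have h1 : Δ.sumHtoD (n + 1) (Δ.nabla n (Δ.atCycle γ (cls (Δ.Kcx γ.1) n z))) =
      (Δ.ses_shortExact.δ n (n + 1) (by simp)).hom
        ((HomologicalComplex.homologyMap (Δ.KtoQ γ) n).hom (cls _ n z)) := by
    rw [← h0]
    exact (Δ.sumHtoDEquiv (n + 1)).apply_symm_apply _
  rw [h1]
  obtain ⟨z₃, hz₃⟩ : ∃ z₃ : LinearMap.ker (Δ.Qcx.d n (n + 1)).hom,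
      z₃.1 = ((Δ.KtoQ γ).f n).hom z.1 := by
    refine ⟨⟨((Δ.KtoQ γ).f n).hom z.1, ?_⟩, rfl⟩
    have := congrArg (fun φ => φ.hom z.1) ((Δ.KtoQ γ).comm n (n + 1))
    refine this.trans ?_
    exact (congrArg ((Δ.KtoQ γ).f (n + 1)).hom z.2).trans (map_zero _)
  rw [cls_map (Δ.KtoQ γ) n z z₃ hz₃.symm]
  refine δ_cls Δ.ses_shortExact n z₃ (⟨Δ.coch z, Δ.K_le_J _ _ (Δ.coch_mem z)⟩ : Δ.J n)
    hz₃.symm t (Subtype.ext ?_)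
  refine h.trans ?_
  change _ = ((Δ.Jcx.d n (n + 1)).hom _ : Δ.J (n + 1)).1
  simp only [Jcx, CochainComplex.of_d]
  rfl

/-! ### Cup products as images of classes of `D^•` -/

/-- The pairs `(y, g)` of an element `y` of `⊕_ω H^n_ω(Δ)` and of a cocycle `g` of `D^n` which have the
same preimage in `⊕_{δ ∈ DQ} H^n_δ(Δ)`, this preimage being moreover supported on the paths of
length `l`. -/
noncomputable def sameClass (l n : ℕ) :
    Submodule k ((⨁ ω : QPath V, Δ.H ω n) × Coch k Δ.Alg n) where
  carrier := { p | ∃ (X : ⨁ δ : DQ V, Δ.H δ.1 n) (t : LinearMap.ker (Δ.Dcx.d n (n + 1)).hom),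
    Δ.inclDQ n X = p.1 ∧ (t.1 : Δ.D n).1 = p.2 ∧ Δ.sumHtoD n X = cls Δ.Dcx n t ∧
      ∀ δ : DQ V, δ.1.length ≠ l → X δ = 0 }
  add_mem' := by
    rintro _ _ ⟨X, t, h1, h2, h3, h4⟩ ⟨X', t', h1', h2', h3', h4'⟩
    refine ⟨X + X', t + t', by rw [map_add, h1, h1']; rfl, ?_, by rw [map_add, map_add, h3, h3'],
      fun δ hδ => by rw [DirectSum.add_apply, h4 δ hδ, h4' δ hδ, add_zero]⟩
    rw [Prod.snd_add, ← h2, ← h2']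
    rfl
  zero_mem' := ⟨0, 0, map_zero _, rfl, by rw [map_zero, map_zero], fun _ _ => rfl⟩
  smul_mem' := by
    rintro c _ ⟨X, t, h1, h2, h3, h4⟩
    refine ⟨c • X, c • t, by rw [map_smul, h1]; rfl, ?_, by rw [map_smul, map_smul, h3],
      fun δ hδ => by rw [DirectSum.smul_apply, h4 δ hδ, smul_zero]⟩
    rw [Prod.smul_snd, ← h2]
    rfl

theorem length_concat (ω' ω : QPath V) (h : ω'.src = ω.tgt) :
    (QPath.concat ω' ω h).length = ω'.length + ω.length := by
  obtain ⟨x', y', p'⟩ := ω'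
  obtain ⟨x, y, p⟩ := ω
  obtain rfl : x' = y := h
  simp [QPath.concat, QPath.length, add_comm]

theorem cls_mem_sameClass (δ : DQ V) {n : ℕ}
    (z : LinearMap.ker ((Δ.Kcx δ.1).d n (n + 1)).hom) :
    (Δ.atPath δ.1 (cls _ n z), Δ.coch z) ∈ Δ.sameClass δ.1.length n := by
  classical
  have hd0 : hd n (Δ.coch z) = 0 :=
    (Δ.hd_of_non_cycle δ.2 (Δ.coch_mem z)).symm.trans (Δ.dPath_coch z)
  refine ⟨DirectSum.lof k (DQ V) (fun δ : DQ V => Δ.H δ.1 n) δ (cls _ n z),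
    ⟨(⟨_, Δ.K_le_D δ n (Δ.coch_mem z)⟩ : Δ.D n), Subtype.ext ((Δ.Dcx_d n _).trans hd0)⟩, ?_, rfl,
    Δ.sumHtoD_lof_cls δ z _ rfl, fun δ' hδ' => ?_⟩
  · rw [inclDQ]
    convert DirectSum.toModule_lof k (M := fun δ : DQ V => Δ.H δ.1 n) δ (cls _ n z)
  · have hne : δ' ≠ δ := fun h => hδ' (by rw [h])
    exact DirectSum.of_eq_of_ne (β := fun δ : DQ V => Δ.H δ.1 n) δ δ' (cls (Δ.Kcx δ.1) n z) hne

theorem cup_mem_sameClass {ω' ω : QPath V} (hω : ω'.src = ω.tgt → ω.src ≠ ω'.tgt) {i j n l : ℕ}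
    (hn : i + j = n) (hl : ω'.length + ω.length = l)
    (z' : LinearMap.ker ((Δ.Kcx ω').d i (i + 1)).hom)
    (z : LinearMap.ker ((Δ.Kcx ω).d j (j + 1)).hom) :
    (Δ.cup hn (Δ.atPath ω' (cls _ i z')) (Δ.atPath ω (cls _ j z)),
      cupC hn (Δ.coch z') (Δ.coch z)) ∈ Δ.sameClass l n := by
  by_cases h : ω'.src = ω.tgt
  · rw [Δ.cup_atPath h, cupH_cls, cupZ_apply, ← hl, ← length_concat ω' ω h]
    exact Δ.cls_mem_sameClass ⟨QPath.concat ω' ω h, hω h⟩ (Δ.cupCoc h hn z' z)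
  · rw [Δ.cup_atPath_of_ne h, Δ.cupC_eq_zero_of_ne h hn (Δ.coch_mem z') (Δ.coch_mem z)]
    exact zero_mem _

theorem sum_mem_sameClass {l n : ℕ} {ι : Type*} (s : Finset ι) {y : ι → ⨁ ω : QPath V, Δ.H ω n}
    {g : ι → Coch k Δ.Alg n} (h : ∀ i ∈ s, (y i, g i) ∈ Δ.sameClass l n) :
    (∑ i ∈ s, y i, ∑ i ∈ s, g i) ∈ Δ.sameClass l n := by
  have hs : (∑ i ∈ s, y i, ∑ i ∈ s, g i) = ∑ i ∈ s, (y i, g i) :=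
    Prod.ext (by rw [Prod.fst_sum]) (by rw [Prod.snd_sum])
  rw [hs]
  exact sum_mem h

theorem cup_oneM_left_mem_sameClass {γ : QPath V} (hγ : γ.src = γ.tgt) {n : ℕ} (hn : 1 + n = n + 1)
    (z : LinearMap.ker ((Δ.Kcx γ).d n (n + 1)).hom) :
    (Δ.cup hn Δ.oneM (Δ.atPath γ (cls _ n z)), cupC hn Δ.oneMCochain (Δ.coch z)) ∈
      Δ.sameClass (γ.length + 1) (n + 1) := by
  simp only [oneM, oneMCochain, map_sum, LinearMap.sum_apply]
  refine Δ.sum_mem_sameClass _ fun x _ => Δ.sum_mem_sameClass _ fun y _ =>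
    Δ.sum_mem_sameClass _ fun a _ => Δ.cup_mem_sameClass (fun h h' => ?_) hn (add_comm _ _)
      (Δ.cocycle _ (Δ.idCochain_mem_K a) (Δ.dPath_idCochain a)) z
  obtain rfl : x = y := h.trans (hγ.symm.trans h')
  exact (SimplyLaced.isEmpty_loop x).false a

theorem cup_oneM_right_mem_sameClass {γ : QPath V} (hγ : γ.src = γ.tgt) {n : ℕ}
    (z : LinearMap.ker ((Δ.Kcx γ).d n (n + 1)).hom) :
    (Δ.cup rfl (Δ.atPath γ (cls _ n z)) Δ.oneM, cupC rfl (Δ.coch z) Δ.oneMCochain) ∈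
      Δ.sameClass (γ.length + 1) (n + 1) := by
  simp only [oneM, oneMCochain, map_sum]
  refine Δ.sum_mem_sameClass _ fun x _ => Δ.sum_mem_sameClass _ fun y _ =>
    Δ.sum_mem_sameClass _ fun a _ => Δ.cup_mem_sameClass (fun h h' => ?_) rfl rfl z
      (Δ.cocycle _ (Δ.idCochain_mem_K a) (Δ.dPath_idCochain a))
  obtain rfl : x = y := h'.trans (hγ.symm.trans h)
  exact (SimplyLaced.isEmpty_loop x).false a

end ZeroQSet
end PathCohomology

theorem mainTheorem4 {k : Type u} [Field k] {V : Type v} [Fintype V] [DecidableEq V]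
    [Quiver.{r} V] [PathCohomology.SimplyLaced V] (Δ : PathCohomology.ZeroQSet.{u, v, w, r} k V)
    (m n : ℕ) (hmn : m ≤ n) (γ : PathCohomology.CQ V) (hγ : γ.1.length = m)
    (f : Δ.H γ.1 n) :
    Δ.inclDQ (n + 1) (Δ.nabla n (Δ.atCycle γ f)) =
        Δ.cup (show 1 + n = n + 1 from Nat.add_comm 1 n) Δ.oneM (Δ.atPath γ.1 f) +
          (-1 : k) ^ (n + 1) • Δ.cup (show n + 1 = n + 1 from rfl) (Δ.atPath γ.1 f) Δ.oneM ∧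
      ∀ δ : PathCohomology.DQ V, δ.1.length ≠ m + 1 → Δ.nabla n (Δ.atCycle γ f) δ = 0 := by
  obtain ⟨z, rfl⟩ := PathCohomology.cls_surjective _ _ f
  obtain ⟨X, t, h1, h2, h3, h4⟩ := add_mem
    (Δ.cup_oneM_left_mem_sameClass γ.2 (Nat.add_comm 1 n) z)
    (Submodule.smul_mem _ ((-1 : k) ^ (n + 1)) (Δ.cup_oneM_right_mem_sameClass γ.2 z))
  have hX : Δ.nabla n (Δ.atCycle γ (PathCohomology.cls _ n z)) = X := by
    refine Δ.sumHtoD_injective (n + 1) (Eq.trans ?_ h3.symm)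
    refine Δ.sumHtoD_nabla_atCycle γ z t (h2.trans ?_)
    exact (Δ.hd_eq_of_cocycle_of_cycle γ.2 (Nat.add_comm 1 n) (Δ.coch_mem z)
      (Δ.dPath_coch z)).symm
  rw [hX]
  exact ⟨h1, fun δ hδ => h4 δ (by rwa [hγ])⟩
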